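/- Let $k$ be an algebraically closed field of characteristic $0$. Let $Q$ be one of the following quivers (an arrow $\alpha_i$ is written above its arrow; the index $5$ does not occur for $\widetilde{E_6}$, $7$ does not occur for $\widetilde{E_7}$, $8$ does not occur for $\widetilde{E_8}$): - $\widetilde{E_6}$, vertices $1,\dots,7$: $\;1\xrightarrow{\alpha_1}2\xrightarrow{\alpha_2}3\xrightarrow{\alpha_3}4\xrightarrow{\alpha_4}5$ and $3\xrightarrow{\alpha_6}6\xrightarrow{\alpha_7}7$; - $\widetilde{E_7}$, vertices $1,\dots,8$: $\;1\xrightarrow{\alpha_1}2\xrightarrow{\alpha_2}3\xrightarrow{\alpha_3}4\xrightarrow{\alpha_4}5\xrightarrow{\alpha_5}6\xrightarrow{\alpha_6}7$ and $4\xrightarrow{\alpha_8}8$; - $\widetilde{E_8}$, vertices $1,\dots,9$: $\;1\xrightarrow{\alpha_1}2\xrightarrow{\alpha_2}3\xrightarrow{\alpha_3}4\xrightarrow{\alpha_4}5\xrightarrow{\alpha_5}6\xrightarrow{\alpha_6}7\xrightarrow{\alpha_7}8$ and $6\xrightarrow{\alpha_9}9$. Let $\bar Q$ be the double of $Q$,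 obtained by adding an arrow $\alpha^*\colon j\to i$ for every arrow $\alpha\colon i\to j$ of $Q$, and let $$A=\Pi(Q)=k\bar Q\Big/\Big(\sum_{\alpha\in Q_1}\alpha\alpha^*-\alpha^*\alpha\Big)$$ be the preprojective algebra, where paths are composed from left to right ($\alpha\beta$ is $\alpha$ followed by $\beta$). It is graded by path length, $A=\bigoplus_{s\ge 0}A_s$, each $A_s$ is finite-dimensional, and $e_i\in A_0$ denotes the trivial path at the vertex $i$. Let $g$ be a graded $k$-algebra automorphism of $A$ that fixes every $e_i$ and satisfies $g(\alpha_i)=c_i\alpha_i$ and $g(\alpha_i^*)=t_i\alpha_i^*$ for all $i$, with scalars $c_i,t_i\in k$. Define vectors $\underline{\operatorname{Tr}}(g,t)$ and $\overline{\operatorname{Tr}}(g,t)$ of formal power series in $k[[t]]$, indexed by the vertices $j$ of $Q$, by $$[\underline{\operatorname{Tr}}(g,t)]_j=\sum_{s\ge0}\operatorname{tr}(g|_{e_jA_s})\,t^s,\qquad [\overline{\operatorname{Tr}}(g,t)]_j=\sum_{s\ge0}\operatorname{tr}(g|_{A_se_j})\,t^s .$$ Let $M$ be the square matrix over $k[[t]]$,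 with rows and columns indexed by the vertices of $Q$, whose diagonal entries are all $d = 1+c_1t_1t^2$, whose $(a,b)$ entry is $-c_it$ and whose $(b,a)$ entry is $-t_it$ for every arrow $\alpha_i\colon a\to b$ of $Q$, and whose other entries are $0$. For $\widetilde{E_6}$, for example, $$M=\begin{pmatrix} d&-c_1t&0&0&0&0&0\\ -t_1t&d&-c_2t&0&0&0&0\\ 0&-t_2t&d&-c_3t&0&-c_6t&0\\ 0&0&-t_3t&d&-c_4t&0&0\\ 0&0&0&-t_4t&d&0&0\\ 0&0&-t_6t&0&0&d&-c_7t\\ 0&0&0&0&0&-t_7t&d\end{pmatrix}.$$ Then, in each of the three cases, $M$ is invertible over $k[[t]]$ and $$\underline{\operatorname{Tr}}(g,t)=M^{-1}\begin{pmatrix}1\\ \vdots\\ 1\end{pmatrix},\qquad \overline{\operatorname{Tr}}(g,t)=(M^{T})^{-1}\begin{pmatrix}1\\ \vdots\\ 1\end{pmatrix}.$$ -/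

import Mathlib

open Quiver

/-! ### Path algebras -/

/-- All paths (of any length `≥ 0`) of the quiver `V`, with source `p.1` and target `p.2.1`. -/
abbrev AllPaths (V : Type*) [Quiver V] := Σ a b : V, Path a b

/-- The path algebra `kV`: the vector space with basis the set of all paths of `V`. -/
def PathAlgebra (k V : Type*) [Field k] [Quiver V] := AllPaths V →₀ k

namespace PathAlgebra

variable {k V : Type*} [Field k] [Quiver V]

noncomputable instance : AddCommGroup (PathAlgebra k V) :=
  inferInstanceAs (AddCommGroup (AllPaths V →₀ k))

noncomputable instance : Module k (PathAlgebra k V) :=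
  inferInstanceAs (Module k (AllPaths V →₀ k))

variable (k) in
/-- The basis vector of the path algebra given by a path. -/
noncomputable def ofPath {a b : V} (p : Path a b) : PathAlgebra k V :=
  Finsupp.single (⟨a, b, p⟩ : AllPaths V) (1 : k)

open Classical in
/-- The product of two paths: their concatenation (first `p`, then `q`) if `p` ends where `q`
starts, and `0` otherwise. -/
noncomputable def pathMul (p q : AllPaths V) : PathAlgebra k V :=
  if h : p.2.1 = q.1 then ofPath k ((p.2.2.cast rfl h).comp q.2.2) else 0

/-- The multiplication of the path algebra, as the bilinear extension of `pathMul`. -/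
noncomputable def mulHom : PathAlgebra k V →ₗ[k] PathAlgebra k V →ₗ[k] PathAlgebra k V :=
  Finsupp.lift (PathAlgebra k V →ₗ[k] PathAlgebra k V) k (AllPaths V)
    (fun p => Finsupp.lift (PathAlgebra k V) k (AllPaths V) (fun q => pathMul p q))

noncomputable instance : Mul (PathAlgebra k V) := ⟨fun x y => mulHom x y⟩

/-- The unit is the sum of all trivial paths. -/
noncomputable instance [Fintype V] : One (PathAlgebra k V) :=
  ⟨∑ i : V, ofPath k (Path.nil : Path i i)⟩

theorem mul_def (x y : PathAlgebra k V) : x * y = mulHom x y := rfl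

theorem one_def [Fintype V] :
    (1 : PathAlgebra k V) = ∑ i : V, ofPath k (Path.nil : Path i i) := rfl

theorem mulHom_ofPath {a b c d : V} (p : Path a b) (q : Path c d) :
    mulHom (ofPath k p) (ofPath k q) = pathMul ⟨a, b, p⟩ ⟨c, d, q⟩ := by
  unfold mulHom ofPath
  erw [Finsupp.lift_apply, Finsupp.sum_single_index, one_smul]
  · erw [Finsupp.lift_apply, Finsupp.sum_single_index, one_smul]
    exact zero_smul _ _
  · exact zero_smul _ _

theorem ofPath_mul_ofPath {a b c : V} (p : Path a b) (q : Path b c) :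
    ofPath k p * ofPath k q = ofPath k (p.comp q) := by
  rw [mul_def, mulHom_ofPath]
  simp [pathMul]

theorem ofPath_mul_ofPath_of_ne {a b c d : V} (p : Path a b) (q : Path c d) (h : b ≠ c) :
    ofPath k p * ofPath k q = 0 := by
  rw [mul_def, mulHom_ofPath]
  simp [pathMul, h]

/-- Every element is a linear combination of paths. -/
theorem induction_on {P : PathAlgebra k V → Prop} (x : PathAlgebra k V) (h0 : P 0)
    (hadd : ∀ x y, P x → P y → P (x + y))
    (hsmul : ∀ (r : k) {a b : V} (p : Path a b), P (r • ofPath k p)) : P x := by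
  refine Finsupp.induction_linear (motive := P) x h0 (fun f g => hadd f g) ?_
  rintro ⟨a, b, p⟩ r
  have h := hsmul r p
  have e : r • ofPath k p = (Finsupp.single (⟨a, b, p⟩ : AllPaths V) r : AllPaths V →₀ k) := by
    unfold ofPath
    erw [Finsupp.smul_single, smul_eq_mul, mul_one]
  rwa [e] at h

theorem add_mul' (x y z : PathAlgebra k V) : (x + y) * z = x * z + y * z := by
  simp [mul_def]

theorem mul_add' (x y z : PathAlgebra k V) : x * (y + z) = x * y + x * z := by
  simp [mul_def]

theorem smul_mul' (r : k) (x y : PathAlgebra k V) : (r • x) * y = r • (x * y) := by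
  simp [mul_def]

theorem mul_smul' (r : k) (x y : PathAlgebra k V) : x * (r • y) = r • (x * y) := by
  simp [mul_def]

theorem zero_mul' (x : PathAlgebra k V) : 0 * x = 0 := by simp [mul_def]

theorem mul_zero' (x : PathAlgebra k V) : x * 0 = 0 := by simp [mul_def]

theorem sum_mul' {ι : Type*} (s : Finset ι) (f : ι → PathAlgebra k V) (x : PathAlgebra k V) :
    (∑ i ∈ s, f i) * x = ∑ i ∈ s, f i * x := by
  simp [mul_def]

theorem mul_sum' {ι : Type*} (s : Finset ι) (f : ι → PathAlgebra k V) (x : PathAlgebra k V) :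
    x * (∑ i ∈ s, f i) = ∑ i ∈ s, x * f i := by
  simp [mul_def]

theorem mul_assoc' (x y z : PathAlgebra k V) : x * y * z = x * (y * z) := by
  refine induction_on (P := fun x => x * y * z = x * (y * z)) x
    (by simp only [zero_mul']) (fun x y hx hy => by simp only [add_mul', hx, hy]) ?_
  intro r a b p
  refine induction_on (P := fun y => r • ofPath k p * y * z = r • ofPath k p * (y * z)) y
    (by simp only [zero_mul', mul_zero'])
    (fun x y hx hy => by simp only [add_mul', mul_add', hx, hy]) ?_
  intro s c d q
  refine induction_on (P := fun z => r • ofPath k p * (s • ofPath k q) * z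
      = r • ofPath k p * (s • ofPath k q * z)) z
    (by simp only [mul_zero']) (fun x y hx hy => by simp only [mul_add', hx, hy]) ?_
  intro t e f w
  simp only [smul_mul', mul_smul']
  congr 3
  by_cases h : b = c
  · subst h
    by_cases h' : d = e
    · subst h'
      simp [ofPath_mul_ofPath]
    · simp [ofPath_mul_ofPath, ofPath_mul_ofPath_of_ne _ _ h', mul_zero']
  · rw [ofPath_mul_ofPath_of_ne _ _ h, zero_mul']
    by_cases h' : d = e
    · subst h'
      rw [ofPath_mul_ofPath, ofPath_mul_ofPath_of_ne _ _ h]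
    · rw [ofPath_mul_ofPath_of_ne _ _ h', mul_zero']

theorem one_mul' [Fintype V] (x : PathAlgebra k V) : 1 * x = x := by
  refine induction_on (P := fun x => 1 * x = x) x (mul_zero' _) (fun x y hx hy => by rw [mul_add', hx, hy]) ?_
  intro r a b p
  rw [mul_smul', one_def, sum_mul', Finset.sum_eq_single a]
  · rw [ofPath_mul_ofPath, Path.nil_comp]
  · intro i _ hi
    exact ofPath_mul_ofPath_of_ne _ _ hi
  · simp

theorem mul_one' [Fintype V] (x : PathAlgebra k V) : x * 1 = x := by
  refine induction_on (P := fun x => x * 1 = x) x (zero_mul' _) (fun x y hx hy => by rw [add_mul', hx, hy]) ?_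
  intro r a b p
  rw [smul_mul', one_def, mul_sum', Finset.sum_eq_single b]
  · rw [ofPath_mul_ofPath, Path.comp_nil]
  · intro i _ hi
    exact ofPath_mul_ofPath_of_ne _ _ hi.symm
  · simp

noncomputable instance [Fintype V] : Ring (PathAlgebra k V) where
  __ := (inferInstance : AddCommGroup (PathAlgebra k V))
  left_distrib := mul_add'
  right_distrib := add_mul'
  zero_mul := zero_mul'
  mul_zero := mul_zero'
  mul_assoc := mul_assoc'
  one_mul := one_mul'
  mul_one := mul_one'

noncomputable instance [Fintype V] : Algebra k (PathAlgebra k V) :=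
  Algebra.ofModule smul_mul' mul_smul'

variable (k V) in
/-- The degree `s` piece of the path algebra: the span of the paths of length `s`. -/
noncomputable def piece (s : ℕ) : Submodule k (PathAlgebra k V) :=
  Submodule.span k {x | ∃ (a b : V) (p : Path a b), p.length = s ∧ x = ofPath k p}

end PathAlgebra

/-! ### Preprojective algebras -/

/-- The double of a quiver (`Quiver.Symmetrify`) has the same vertices. -/
instance {V : Type*} [Fintype V] : Fintype (Symmetrify V) := inferInstanceAs (Fintype V)

section Preprojective

variable (k V : Type*) [Field k] [Quiver V] [Fintype V]

/-- The element `∑_α (α α* - α* α)` of the path algebra of the double, the sum being over all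
arrows `α` of the quiver. -/
noncomputable def preprojectiveRelation [∀ a b : V, Fintype (a ⟶ b)] :
    PathAlgebra k (Symmetrify V) :=
  ∑ a : V, ∑ b : V, ∑ α : a ⟶ b,
    (PathAlgebra.ofPath k (Hom.toPos α).toPath * PathAlgebra.ofPath k (Hom.toNeg α).toPath
      - PathAlgebra.ofPath k (Hom.toNeg α).toPath * PathAlgebra.ofPath k (Hom.toPos α).toPath)

variable [∀ a b : V, Fintype (a ⟶ b)]

/-- The two-sided ideal generated by `preprojectiveRelation`. -/
noncomputable def preprojectiveIdeal : TwoSidedIdeal (PathAlgebra k (Symmetrify V)) :=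
  TwoSidedIdeal.span {preprojectiveRelation k V}

/-- The preprojective algebra `Π(V)`. -/
abbrev PreprojectiveAlgebra :=
  PathAlgebra k (Symmetrify V) ⧸ (preprojectiveIdeal k V).asIdeal

namespace PreprojectiveAlgebra

variable {V}

/-- The class in `Π(V)` of a path of the double. -/
noncomputable def ofPath {a b : Symmetrify V} (p : Path a b) : PreprojectiveAlgebra k V :=
  Ideal.Quotient.mkₐ k (preprojectiveIdeal k V).asIdeal (PathAlgebra.ofPath k p)

/-- The idempotent `e_i`, the class of the trivial path at `i`. -/
noncomputable def idem (i : V) : PreprojectiveAlgebra k V :=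
  ofPath k (Path.nil : Path (V := Symmetrify V) i i)

/-- The class of an arrow `α` of the quiver. -/
noncomputable def arrow {a b : V} (α : a ⟶ b) : PreprojectiveAlgebra k V :=
  ofPath k (Hom.toPos α).toPath

/-- The class of the opposite arrow `α*`. -/
noncomputable def arrowStar {a b : V} (α : a ⟶ b) : PreprojectiveAlgebra k V :=
  ofPath k (Hom.toNeg α).toPath

variable (V)

/-- The degree `s` piece `A_s` of `A = Π(V)`, for the grading by path length. -/
noncomputable def piece (s : ℕ) : Submodule k (PreprojectiveAlgebra k V) :=
  (PathAlgebra.piece k (Symmetrify V) s).map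
    (Ideal.Quotient.mkₐ k (preprojectiveIdeal k V).asIdeal).toLinearMap

variable {V}

/-- The subspace `e_j A_s`. -/
noncomputable def rightPiece (j : V) (s : ℕ) : Submodule k (PreprojectiveAlgebra k V) :=
  (piece k V s).map (LinearMap.mulLeft k (idem k j))

/-- The subspace `A_s e_j`. -/
noncomputable def leftPiece (j : V) (s : ℕ) : Submodule k (PreprojectiveAlgebra k V) :=
  (piece k V s).map (LinearMap.mulRight k (idem k j))

variable {k}

/-- `g` is a graded automorphism of `Π(V)` fixing the idempotents `e_i`. -/
structure IsGradedAut (g : PreprojectiveAlgebra k V ≃ₐ[k] PreprojectiveAlgebra k V) : Prop where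
  map_piece : ∀ s, (piece k V s).map g.toLinearMap = piece k V s
  map_idem : ∀ i, g (idem k i) = idem k i

/-- `g` scales the arrows: `g(α) = c_α α` and `g(α*) = t_α α*` for every arrow `α`. -/
def ScalesArrows (g : PreprojectiveAlgebra k V ≃ₐ[k] PreprojectiveAlgebra k V)
    (c t : ∀ ⦃a b : V⦄, (a ⟶ b) → k) : Prop :=
  ∀ ⦃a b : V⦄ (α : a ⟶ b),
    g (arrow k α) = c α • arrow k α ∧ g (arrowStar k α) = t α • arrowStar k α

theorem IsGradedAut.mapsTo_rightPiece
    {g : PreprojectiveAlgebra k V ≃ₐ[k] PreprojectiveAlgebra k V} (hg : IsGradedAut g)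
    (j : V) (s : ℕ) : ∀ x ∈ rightPiece k j s, g.toLinearMap x ∈ rightPiece k j s := by
  rintro _ ⟨x, hx, rfl⟩
  refine ⟨g x, ?_, ?_⟩
  · rw [← hg.map_piece s]
    exact ⟨x, hx, rfl⟩
  · simp [hg.map_idem]

theorem IsGradedAut.mapsTo_leftPiece
    {g : PreprojectiveAlgebra k V ≃ₐ[k] PreprojectiveAlgebra k V} (hg : IsGradedAut g)
    (j : V) (s : ℕ) : ∀ x ∈ leftPiece k j s, g.toLinearMap x ∈ leftPiece k j s := by
  rintro _ ⟨x, hx, rfl⟩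
  refine ⟨g x, ?_, ?_⟩
  · rw [← hg.map_piece s]
    exact ⟨x, hx, rfl⟩
  · simp [hg.map_idem]

open scoped PowerSeries in
/-- The vector trace whose `j`-th entry is `∑_s tr(g | e_j A_s) t^s`. -/
noncomputable def lowerVectorTrace (g : PreprojectiveAlgebra k V ≃ₐ[k] PreprojectiveAlgebra k V)
    (hg : IsGradedAut g) : V → k⟦X⟧ := fun j =>
  PowerSeries.mk fun s =>
    LinearMap.trace k (rightPiece k j s) (g.toLinearMap.restrict (hg.mapsTo_rightPiece j s))

open scoped PowerSeries in
/-- The vector trace whose `j`-th entry is `∑_s tr(g | A_s e_j) t^s`. -/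
noncomputable def upperVectorTrace (g : PreprojectiveAlgebra k V ≃ₐ[k] PreprojectiveAlgebra k V)
    (hg : IsGradedAut g) : V → k⟦X⟧ := fun j =>
  PowerSeries.mk fun s =>
    LinearMap.trace k (leftPiece k j s) (g.toLinearMap.restrict (hg.mapsTo_leftPiece j s))

variable (k)

/-- For a finite quiver every `A_s` is finite dimensional, so that the traces in
`lowerVectorTrace` and `upperVectorTrace` are traces on finite-dimensional spaces. -/
theorem finite_piece (s : ℕ) : Module.Finite k (piece k V s) := by
  have hfin : ∀ s : ℕ, {p : AllPaths (Symmetrify V) | p.2.2.length = s}.Finite := by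
    have (a b : Symmetrify V) : Finite (a ⟶ b) :=
      inferInstanceAs (Finite (((show V from a) ⟶ (show V from b)) ⊕
        ((show V from b) ⟶ (show V from a))))
    intro s
    induction s with
    | zero =>
      refine (Set.finite_range
        (fun a : Symmetrify V => (⟨a, a, Path.nil⟩ : AllPaths (Symmetrify V)))).subset ?_
      rintro ⟨a, b, p⟩ hp
      cases p with
      | nil => exact ⟨a, rfl⟩
      | cons p e => simp at hp
    | succ s ih =>
      have : Finite {p : AllPaths (Symmetrify V) // p.2.2.length = s} := ih.to_subtype
      refine (Set.finite_range (fun x : (Σ (p : {p : AllPaths (Symmetrify V) //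
        p.2.2.length = s}) (c : Symmetrify V), (p.1.2.1 ⟶ c)) =>
          (⟨x.1.1.1, x.2.1, x.1.1.2.2.cons x.2.2⟩ : AllPaths (Symmetrify V)))).subset ?_
      rintro ⟨a, b, p⟩ hp
      cases p with
      | nil => simp at hp
      | cons p e => exact ⟨⟨⟨⟨a, _, p⟩, by simpa using hp⟩, _, e⟩, rfl⟩
  have : Module.Finite k (PathAlgebra.piece k (Symmetrify V) s) := by
    refine Module.Finite.span_of_finite k (((hfin s).image
      (fun p => PathAlgebra.ofPath k p.2.2)).subset ?_)
    rintro _ ⟨a, b, p, hp, rfl⟩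
    exact ⟨⟨a, b, p⟩, hp, rfl⟩
  unfold piece
  infer_instance

end PreprojectiveAlgebra

end Preprojective

/-! ### The quivers of type `Ẽ₆`, `Ẽ₇`, `Ẽ₈`

The vertices `1, 2, 3, …` are represented by `0, 1, 2, …`. -/

/-- The vertices of `Ẽ₆`. -/
def E6Tilde := Fin 7

instance : Fintype E6Tilde := inferInstanceAs (Fintype (Fin 7))
instance : DecidableEq E6Tilde := inferInstanceAs (DecidableEq (Fin 7))

/-- The arrows `1 → 2 → 3 → 4 → 5` and `3 → 6 → 7`. -/
inductive E6Arrow : Fin 7 → Fin 7 → Type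
  | α₁ : E6Arrow 0 1
  | α₂ : E6Arrow 1 2
  | α₃ : E6Arrow 2 3
  | α₄ : E6Arrow 3 4
  | α₆ : E6Arrow 2 5
  | α₇ : E6Arrow 5 6

instance : Quiver E6Tilde := ⟨E6Arrow⟩

instance (a b : E6Tilde) : Subsingleton (a ⟶ b) :=
  ⟨fun (x y : E6Arrow a b) => by cases x <;> cases y <;> rfl⟩

noncomputable instance (a b : E6Tilde) : Fintype (a ⟶ b) := Fintype.ofFinite _

/-- The vertices of `Ẽ₇`. -/
def E7Tilde := Fin 8

instance : Fintype E7Tilde := inferInstanceAs (Fintype (Fin 8))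
instance : DecidableEq E7Tilde := inferInstanceAs (DecidableEq (Fin 8))

/-- The arrows `1 → 2 → 3 → 4 → 5 → 6 → 7` and `4 → 8`. -/
inductive E7Arrow : Fin 8 → Fin 8 → Type
  | α₁ : E7Arrow 0 1
  | α₂ : E7Arrow 1 2
  | α₃ : E7Arrow 2 3
  | α₄ : E7Arrow 3 4
  | α₅ : E7Arrow 4 5
  | α₆ : E7Arrow 5 6
  | α₈ : E7Arrow 3 7

instance : Quiver E7Tilde := ⟨E7Arrow⟩

instance (a b : E7Tilde) : Subsingleton (a ⟶ b) :=
  ⟨fun (x y : E7Arrow a b) => by cases x <;> cases y <;> rfl⟩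

noncomputable instance (a b : E7Tilde) : Fintype (a ⟶ b) := Fintype.ofFinite _

/-- The vertices of `Ẽ₈`. -/
def E8Tilde := Fin 9

instance : Fintype E8Tilde := inferInstanceAs (Fintype (Fin 9))
instance : DecidableEq E8Tilde := inferInstanceAs (DecidableEq (Fin 9))

/-- The arrows `1 → 2 → 3 → 4 → 5 → 6 → 7 → 8` and `6 → 9`. -/
inductive E8Arrow : Fin 9 → Fin 9 → Type
  | α₁ : E8Arrow 0 1
  | α₂ : E8Arrow 1 2
  | α₃ : E8Arrow 2 3
  | α₄ : E8Arrow 3 4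
  | α₅ : E8Arrow 4 5
  | α₆ : E8Arrow 5 6
  | α₇ : E8Arrow 6 7
  | α₉ : E8Arrow 5 8

instance : Quiver E8Tilde := ⟨E8Arrow⟩

instance (a b : E8Tilde) : Subsingleton (a ⟶ b) :=
  ⟨fun (x y : E8Arrow a b) => by cases x <;> cases y <;> rfl⟩

noncomputable instance (a b : E8Tilde) : Fintype (a ⟶ b) := Fintype.ofFinite _

/-! ### The matrices -/

section Matrices

open PowerSeries

variable {k : Type*} [Field k]

/-- The matrix for `Ẽ₆`; here `d = 1 + c₁ t₁ t²` and `u x = -x t`. -/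
noncomputable def E6Matrix (c t : ∀ ⦃a b : E6Tilde⦄, (a ⟶ b) → k) :
    Matrix E6Tilde E6Tilde k⟦X⟧ :=
  let c₁ := c E6Arrow.α₁
  let c₂ := c E6Arrow.α₂
  let c₃ := c E6Arrow.α₃
  let c₄ := c E6Arrow.α₄
  let c₆ := c E6Arrow.α₆
  let c₇ := c E6Arrow.α₇
  let t₁ := t E6Arrow.α₁
  let t₂ := t E6Arrow.α₂
  let t₃ := t E6Arrow.α₃
  let t₄ := t E6Arrow.α₄
  let t₆ := t E6Arrow.α₆
  let t₇ := t E6Arrow.α₇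
  let d : k⟦X⟧ := 1 + C (c₁ * t₁) * X ^ 2
  let u : k → k⟦X⟧ := fun x => -(C x * X)
  show Matrix (Fin 7) (Fin 7) k⟦X⟧ from
  !![d,    u c₁, 0,    0,    0,    0,    0;
     u t₁, d,    u c₂, 0,    0,    0,    0;
     0,    u t₂, d,    u c₃, 0,    u c₆, 0;
     0,    0,    u t₃, d,    u c₄, 0,    0;
     0,    0,    0,    u t₄, d,    0,    0;
     0,    0,    u t₆, 0,    0,    d,    u c₇;
     0,    0,    0,    0,    0,    u t₇, d]

/-- The matrix for `Ẽ₇`; here `d = 1 + c₁ t₁ t²` and `u x = -x t`. -/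
noncomputable def E7Matrix (c t : ∀ ⦃a b : E7Tilde⦄, (a ⟶ b) → k) :
    Matrix E7Tilde E7Tilde k⟦X⟧ :=
  let c₁ := c E7Arrow.α₁
  let c₂ := c E7Arrow.α₂
  let c₃ := c E7Arrow.α₃
  let c₄ := c E7Arrow.α₄
  let c₅ := c E7Arrow.α₅
  let c₆ := c E7Arrow.α₆
  let c₈ := c E7Arrow.α₈
  let t₁ := t E7Arrow.α₁
  let t₂ := t E7Arrow.α₂
  let t₃ := t E7Arrow.α₃
  let t₄ := t E7Arrow.α₄
  let t₅ := t E7Arrow.α₅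
  let t₆ := t E7Arrow.α₆
  let t₈ := t E7Arrow.α₈
  let d : k⟦X⟧ := 1 + C (c₁ * t₁) * X ^ 2
  let u : k → k⟦X⟧ := fun x => -(C x * X)
  show Matrix (Fin 8) (Fin 8) k⟦X⟧ from
  !![d,    u c₁, 0,    0,    0,    0,    0,    0;
     u t₁, d,    u c₂, 0,    0,    0,    0,    0;
     0,    u t₂, d,    u c₃, 0,    0,    0,    0;
     0,    0,    u t₃, d,    u c₄, 0,    0,    u c₈;
     0,    0,    0,    u t₄, d,    u c₅, 0,    0;
     0,    0,    0,    0,    u t₅, d,    u c₆, 0;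
     0,    0,    0,    0,    0,    u t₆, d,    0;
     0,    0,    0,    u t₈, 0,    0,    0,    d]

/-- The matrix for `Ẽ₈`; here `d = 1 + c₁ t₁ t²` and `u x = -x t`. -/
noncomputable def E8Matrix (c t : ∀ ⦃a b : E8Tilde⦄, (a ⟶ b) → k) :
    Matrix E8Tilde E8Tilde k⟦X⟧ :=
  let c₁ := c E8Arrow.α₁
  let c₂ := c E8Arrow.α₂
  let c₃ := c E8Arrow.α₃
  let c₄ := c E8Arrow.α₄
  let c₅ := c E8Arrow.α₅
  let c₆ := c E8Arrow.α₆
  let c₇ := c E8Arrow.α₇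
  let c₉ := c E8Arrow.α₉
  let t₁ := t E8Arrow.α₁
  let t₂ := t E8Arrow.α₂
  let t₃ := t E8Arrow.α₃
  let t₄ := t E8Arrow.α₄
  let t₅ := t E8Arrow.α₅
  let t₆ := t E8Arrow.α₆
  let t₇ := t E8Arrow.α₇
  let t₉ := t E8Arrow.α₉
  let d : k⟦X⟧ := 1 + C (c₁ * t₁) * X ^ 2
  let u : k → k⟦X⟧ := fun x => -(C x * X)
  show Matrix (Fin 9) (Fin 9) k⟦X⟧ from
  !![d,    u c₁, 0,    0,    0,    0,    0,    0,    0;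
     u t₁, d,    u c₂, 0,    0,    0,    0,    0,    0;
     0,    u t₂, d,    u c₃, 0,    0,    0,    0,    0;
     0,    0,    u t₃, d,    u c₄, 0,    0,    0,    0;
     0,    0,    0,    u t₄, d,    u c₅, 0,    0,    0;
     0,    0,    0,    0,    u t₅, d,    u c₆, 0,    u c₉;
     0,    0,    0,    0,    0,    u t₆, d,    u c₇, 0;
     0,    0,    0,    0,    0,    0,    u t₇, d,    0;
     0,    0,    0,    0,    0,    u t₉, 0,    0,    d]

end Matrices

/-! Let `T_i` be the series of traces on the spaces `e_i A_s`. The equations come from exact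
sequences `0 → e_i A_s → ⨁ e_b A_(s+1) → e_i A_(s+2) → 0`, where the sum runs over the arrows `β : i
→ b` of the double. The first map is `y ↦ (ε(β) β* y)` and the second is `(x_β) ↦ ∑ β x_β`. They are
equivariant once `g` is rescaled by the weight `w_β` on each middle summand and by a scalar `l` on
the left term. Since `g` preserves the mesh relation at `i`, the products of the weights of `β` and
`β*` agree for all arrows at `i`; as the quiver is connected, they all equal `l = c₁ t₁`. Additivity
of traces then gives a recursion in `s`. With the values in degrees `0` and `1` it becomes `(1 + l
t²) T_i - ∑ w_β t T_b = 1`, the `i`-th row of `M T = 1`. The matrix `M` is invertible because its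
constant term is the identity. Reversal of paths exchanges `e_j A_s` with `A_s e_j` and `c` with
`t`, hence `M` with its transpose.

Exactness in the middle and on the right follows from the presentation of `A` for any finite quiver
(`exists_eq_of_sum_mem_preprojectiveIdeal`, `isMeshModule_cornerAct`). Injectivity on the left says
that no nonzero element is killed by left multiplication with all arrows, and this is where the
extended Dynkin shape enters. It is proved for each `A e_j` separately (`hasNoSocle_of_nontrivial`).
A nonzero killed element of minimal degree `s` gives a rank-one endomorphism of the degree `s`
slice, compatible with the zero map on degree `s + 1`. Exactness below `s` extends it step by step
down to degree `0`, where only scalars exist. So it is a nonzero scalar which also acts as `0` on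
degree `s + 1`, and that degree must vanish.

No degree vanishes, however (`nontrivial_of_additive`). If `δ` is the positive function with `∑ δ_b
= 2 δ_i` over the neighbours `b` of `i`, then the dimension weighted by `δ` is a convex sequence in
`s` with positive initial value and increasing first step. -/

/-! ### Traces and exact sequences -/

/-- The trace is additive on short exact sequences. -/
theorem LinearMap.trace_eq_add_of_shortExact {k U V W : Type*} [Field k]
    [AddCommGroup U] [Module k U] [AddCommGroup V] [Module k V] [AddCommGroup W] [Module k W]
    [FiniteDimensional k U] [FiniteDimensional k V] [FiniteDimensional k W]
    (i : W →ₗ[k] V) (p : V →ₗ[k] U) (hi : Function.Injective i) (hp : Function.Surjective p)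
    (hip : ∀ w, p (i w) = 0) (hex : ∀ v, p v = 0 → ∃ w, i w = v)
    (fW : W →ₗ[k] W) (fV : V →ₗ[k] V) (fU : U →ₗ[k] U)
    (hW : ∀ w, fV (i w) = i (fW w)) (hU : ∀ v, p (fV v) = fU (p v)) :
    LinearMap.trace k V fV = LinearMap.trace k W fW + LinearMap.trace k U fU := by
  obtain ⟨s, hs⟩ := p.exists_rightInverse_of_surjective (LinearMap.range_eq_top.2 hp)
  obtain ⟨r₀, hr₀⟩ := i.exists_leftInverse_of_injective (LinearMap.ker_eq_bot.2 hi)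
  have hs' : ∀ u, p (s u) = u := fun u => LinearMap.congr_fun hs u
  have hr' : ∀ w, r₀ (i w) = w := fun w => LinearMap.congr_fun hr₀ w
  set r : V →ₗ[k] W := r₀ ∘ₗ (LinearMap.id - s ∘ₗ p) with hr
  -- The splitting writes `fV` as a map factoring through `W` plus one factoring through `U`;
  -- cyclicity of the trace then carries each summand to its own space.
  have h1 : fV = (i ∘ₗ fW) ∘ₗ r + (fV ∘ₗ s) ∘ₗ p := by
    ext v
    obtain ⟨w, hw⟩ := hex (v - s (p v)) (by simp [hs'])
    have hrv : r v = w := by simp [hr, ← hw, hr']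
    have : v = i w + s (p v) := by rw [hw]; abel
    simp only [LinearMap.add_apply, LinearMap.comp_apply, hrv, ← hW]
    rw [← map_add, ← this]
  have h2 : r ∘ₗ (i ∘ₗ fW) = fW := by
    ext w
    simp [hr, hip, hr']
  have h3 : p ∘ₗ (fV ∘ₗ s) = fU := by
    ext u
    simp [hU, hs']
  rw [h1, map_add, LinearMap.trace_comp_comm' r, LinearMap.trace_comp_comm' p, h2, h3]

/-- The trace of an endomorphism of a finite product acting componentwise. -/
theorem LinearMap.trace_pi_eq_sum {k ι : Type*} [Field k] [Fintype ι] {M : ι → Type*}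
    [∀ b, AddCommGroup (M b)] [∀ b, Module k (M b)] [∀ b, FiniteDimensional k (M b)]
    (f : ∀ b, M b →ₗ[k] M b) :
    LinearMap.trace k (∀ b, M b) (LinearMap.pi fun b => f b ∘ₗ LinearMap.proj b)
      = ∑ b, LinearMap.trace k (M b) (f b) := by
  classical
  have h : (LinearMap.pi fun b => f b ∘ₗ LinearMap.proj b)
      = ∑ b, LinearMap.single k M b ∘ₗ (f b ∘ₗ LinearMap.proj b) := by
    ext b x c
    simp [Finset.sum_apply, Finset.sum_pi_single]
  rw [h, map_sum]
  refine Finset.sum_congr rfl fun b _ => ?_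
  rw [LinearMap.trace_comp_comm', LinearMap.comp_assoc]
  congr 1
  ext x
  simp

/-! ### Mesh modules -/

section MeshModule

variable {k : Type*} [Field k] {W : Type*} [Quiver W] [HasInvolutiveReverse W]
  [∀ i : W, Fintype (Quiver.Star i)] {N : W → ℕ → Type*} [∀ i s, AddCommGroup (N i s)]
  [∀ i s, Module k (N i s)]

/-- A graded representation of a quiver with involution, generated in degree `0`, on which the
signed mesh relations hold and generate all relations. -/
structure IsMeshModule (ε : ∀ ⦃a b : W⦄, (a ⟶ b) → k)
    (act : ∀ ⦃a b : W⦄, (a ⟶ b) → ∀ s, N b s →ₗ[k] N a (s + 1)) : Prop where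
  sign_ne_zero : ∀ ⦃a b : W⦄ (β : a ⟶ b), ε β ≠ 0
  surjective : ∀ i s (x : N i (s + 1)), ∃ y : ∀ b : Quiver.Star i, N b.1 s, ∑ b, act b.2 s (y b) = x
  mesh : ∀ i s (y : N i s),
    ∑ b : Quiver.Star i, ε b.2 • act b.2 (s + 1) (act (reverse b.2) s y) = 0
  exact_zero : ∀ i (x : ∀ b : Quiver.Star i, N b.1 0), ∑ b, act b.2 0 (x b) = 0 → x = 0
  exact_succ : ∀ i s (x : ∀ b : Quiver.Star i, N b.1 (s + 1)), ∑ b, act b.2 (s + 1) (x b) = 0 →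
    ∃ y : N i s, ∀ b : Quiver.Star i, x b = ε b.2 • act (reverse b.2) s y

/-- There is no nonzero element of degree `s` killed by all arrows. -/
def HasNoSocle (act : ∀ ⦃a b : W⦄, (a ⟶ b) → ∀ s, N b s →ₗ[k] N a (s + 1)) (s : ℕ) : Prop :=
  ∀ i (y : N i s), (∀ b : Quiver.Star i, act (reverse b.2) s y = 0) → y = 0

namespace IsMeshModule

variable {ε : ∀ ⦃a b : W⦄, (a ⟶ b) → k}
  {act : ∀ ⦃a b : W⦄, (a ⟶ b) → ∀ s, N b s →ₗ[k] N a (s + 1)}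

/-- An endomorphism of a slice extends to the preceding degree. -/
theorem exists_extend_endomorphism (h : IsMeshModule ε act) {s : ℕ} (hs : HasNoSocle act s)
    (θ : ∀ i, N i (s + 1) →ₗ[k] N i (s + 1)) (θ' : ∀ i, N i (s + 2) →ₗ[k] N i (s + 2))
    (hθ : ∀ ⦃a b : W⦄ (β : a ⟶ b) (y : N b (s + 1)),
      θ' a (act β (s + 1) y) = act β (s + 1) (θ b y)) :
    ∃ θ₀ : ∀ i, N i s →ₗ[k] N i s, ∀ ⦃a b : W⦄ (β : a ⟶ b) (y : N b s),
      θ a (act β s y) = act β s (θ₀ b y) := by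
  let ι : ∀ i, N i s →ₗ[k] ∀ b : Quiver.Star i, N b.1 (s + 1) :=
    fun i => LinearMap.pi fun b => act (reverse b.2) s
  have hι : ∀ i, ∃ r : (∀ b : Quiver.Star i, N b.1 (s + 1)) →ₗ[k] N i s, r ∘ₗ ι i = LinearMap.id := by
    intro i
    refine (ι i).exists_leftInverse_of_injective (LinearMap.ker_eq_bot'.2 fun y hy => ?_)
    exact hs i y fun b => congrFun hy b
  choose r hr using hι
  refine ⟨fun i => r i ∘ₗ LinearMap.pi fun b : Quiver.Star i => θ b.1 ∘ₗ act (reverse b.2) s, ?_⟩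
  intro a b β y
  -- Applying `θ'` to the mesh relation of `y` shows that the transported family is again a linear
  -- relation. Middle exactness produces `z`, which is to be `θ₀ y`.
  obtain ⟨z, hz⟩ := h.exact_succ b s (fun c => ε c.2 • θ c.1 (act (reverse c.2) s y)) (by
    have := congrArg (θ' b) (h.mesh b s y)
    rw [map_zero, map_sum] at this
    rw [← this]
    refine Finset.sum_congr rfl fun c _ => ?_
    rw [map_smul, map_smul, hθ])
  have hz' : ∀ c : Quiver.Star b, θ c.1 (act (reverse c.2) s y) = act (reverse c.2) s z :=
    fun c => smul_right_injective _ (h.sign_ne_zero c.2) (hz c)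
  -- `r` is only a left inverse of `ι`, but the family to which it is applied lies in the range of
  -- `ι`, so it returns `z`.
  have hyz : (r b ∘ₗ LinearMap.pi fun c : Quiver.Star b => θ c.1 ∘ₗ act (reverse c.2) s) y = z := by
    have h1 : (LinearMap.pi fun c : Quiver.Star b => θ c.1 ∘ₗ act (reverse c.2) s) y = ι b z := by
      funext c
      exact hz' c
    rw [LinearMap.comp_apply, h1]
    exact LinearMap.congr_fun (hr b) z
  rw [hyz]
  have := hz' ⟨a, reverse β⟩
  simpa only [reverse_reverse] using this

/-- Endomorphisms of a slice are scalars. -/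
theorem endomorphism_eq_smul (h : IsMeshModule ε act)
    (h0 : ∀ θ : ∀ i, N i 0 →ₗ[k] N i 0, ∃ l : k, ∀ i y, θ i y = l • y) {s : ℕ}
    (hs : ∀ m < s, HasNoSocle act m)
    (θ : ∀ i, N i s →ₗ[k] N i s) (θ' : ∀ i, N i (s + 1) →ₗ[k] N i (s + 1))
    (hθ : ∀ ⦃a b : W⦄ (β : a ⟶ b) (y : N b s), θ' a (act β s y) = act β s (θ b y)) :
    ∃ l : k, (∀ i y, θ i y = l • y) ∧ ∀ i y, θ' i y = l • y := by
  -- Degree `s + 1` is generated by degree `s`, so `θ'` is determined by `θ`.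
  suffices ∃ l : k, ∀ i y, θ i y = l • y by
    obtain ⟨l, hl⟩ := this
    refine ⟨l, hl, fun i x => ?_⟩
    obtain ⟨y, rfl⟩ := h.surjective i s x
    simp only [map_sum, hθ, hl, map_smul, Finset.smul_sum]
  induction s with
  | zero => exact h0 θ
  | succ s ih =>
    -- The pair in degrees `(s + 1, s + 2)` is replaced by `(θ₀, θ)` in degrees `(s, s + 1)`, down
    -- to degree `0`.
    obtain ⟨θ₀, hθ₀⟩ := h.exists_extend_endomorphism (hs s s.lt_succ_self) θ θ' hθ
    obtain ⟨l, hl⟩ := ih (fun m hm => hs m (hm.trans s.lt_succ_self)) θ₀ θ hθ₀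
    refine ⟨l, fun i x => ?_⟩
    obtain ⟨y, rfl⟩ := h.surjective i s x
    simp only [map_sum, hθ₀, hl, map_smul, Finset.smul_sum]

/-- A mesh module with scalar endomorphisms in degree `0` that does not vanish in any positive
degree has no socle. -/
theorem hasNoSocle_of_nontrivial (h : IsMeshModule ε act)
    (h0 : ∀ θ : ∀ i, N i 0 →ₗ[k] N i 0, ∃ l : k, ∀ i y, θ i y = l • y)
    (hN : ∀ s, ∃ i, Nontrivial (N i (s + 1))) (s : ℕ) : HasNoSocle act s := by
  classical
  induction s using Nat.strong_induction_on with
  | _ s ih =>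
    intro i y hy
    by_contra hne
    obtain ⟨f, hf⟩ := Module.Projective.exists_dual_ne_zero k hne
    -- A rank-one map with image spanned by `y`. Since all arrows kill `y`, it is compatible with
    -- the zero map in degree `s + 1`; the choice `f y ≠ 0` makes its scalar nonzero.
    let θ : ∀ i, N i s →ₗ[k] N i s := Function.update 0 i (f.smulRight y)
    obtain ⟨l, hl, hl'⟩ := h.endomorphism_eq_smul h0 ih θ 0 (by
      intro a b β z
      rcases eq_or_ne b i with rfl | hb
      · have := hy ⟨a, reverse β⟩
        simp only [reverse_reverse] at this
        simp [θ, this]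
      · simp [θ, hb])
    have h1 := hl i y
    simp only [θ, Function.update_self, LinearMap.smulRight_apply] at h1
    have h2 : l ≠ 0 := by
      rintro rfl
      rw [zero_smul, smul_eq_zero] at h1
      exact h1.elim hf hne
    obtain ⟨j, hj⟩ := hN s
    obtain ⟨x, hx⟩ := exists_ne (0 : N j (s + 1))
    have h3 := hl' j x
    rw [Pi.zero_apply, LinearMap.zero_apply, eq_comm, smul_eq_zero] at h3
    exact h3.elim h2 hx

variable [∀ i s, FiniteDimensional k (N i s)]

/-- Only an inequality is available, because injectivity of the left map is not yet known; it
suffices for the growth argument that later yields injectivity. -/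
theorem sum_finrank_le (h : IsMeshModule ε act) (i : W) (s : ℕ) :
    ∑ b : Quiver.Star i, Module.finrank k (N b.1 (s + 1))
      ≤ Module.finrank k (N i (s + 2)) + Module.finrank k (N i s) := by
  let p : (∀ b : Quiver.Star i, N b.1 (s + 1)) →ₗ[k] N i (s + 2) :=
    ∑ b : Quiver.Star i, act b.2 (s + 1) ∘ₗ LinearMap.proj b
  let q : N i s →ₗ[k] (∀ b : Quiver.Star i, N b.1 (s + 1)) :=
    LinearMap.pi fun b => ε b.2 • act (reverse b.2) s
  have hker : LinearMap.ker p ≤ LinearMap.range q := by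
    intro x hx
    obtain ⟨y, hy⟩ := h.exact_succ i s x (by simpa [p, LinearMap.sum_apply] using hx)
    exact ⟨y, funext fun b => (hy b).symm⟩
  rw [← Module.finrank_pi_fintype, ← p.finrank_range_add_finrank_ker]
  exact add_le_add (Submodule.finrank_le _)
    ((Submodule.finrank_mono hker).trans q.finrank_range_le)

theorem sum_finrank_zero_le (h : IsMeshModule ε act) (i : W) :
    ∑ b : Quiver.Star i, Module.finrank k (N b.1 0) ≤ Module.finrank k (N i 1) := by
  let p : (∀ b : Quiver.Star i, N b.1 0) →ₗ[k] N i 1 :=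
    ∑ b : Quiver.Star i, act b.2 0 ∘ₗ LinearMap.proj b
  have hker : LinearMap.ker p = ⊥ := by
    refine LinearMap.ker_eq_bot'.2 fun x hx => ?_
    exact h.exact_zero i x (by simpa [p, LinearMap.sum_apply] using hx)
  rw [← Module.finrank_pi_fintype]
  exact LinearMap.finrank_le_finrank_of_injective (LinearMap.ker_eq_bot.1 hker)

end IsMeshModule

/-- Summing over arrows is symmetric under reversal. -/
theorem sum_star_comm [Fintype W] {M : Type*} [AddCommMonoid M] (F : W → W → M) :
    ∑ i, ∑ b : Quiver.Star i, F i b.1 = ∑ i, ∑ b : Quiver.Star i, F b.1 i := by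
  rw [← Fintype.sum_sigma' (fun i (b : Quiver.Star i) => F i b.1),
    ← Fintype.sum_sigma' (fun i (b : Quiver.Star i) => F b.1 i)]
  let e : (Σ i : W, Quiver.Star i) → Σ i : W, Quiver.Star i := fun x => ⟨x.2.1, ⟨x.1, reverse x.2.2⟩⟩
  have he : Function.Involutive e := by
    rintro ⟨i, b, β⟩
    simp [e]
  exact Fintype.sum_equiv he.toPerm _ _ fun _ => rfl

/-! ### Growth of dimensions and the trace recursion -/

namespace IsMeshModule

variable {ε : ∀ ⦃a b : W⦄, (a ⟶ b) → k}
  {act : ∀ ⦃a b : W⦄, (a ⟶ b) → ∀ s, N b s →ₗ[k] N a (s + 1)}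
  [∀ i s, FiniteDimensional k (N i s)]

/-- If the quiver has a positive additive function, a nonzero mesh module does not vanish in any
degree. -/
theorem nontrivial_of_additive [Fintype W] (h : IsMeshModule ε act) (δ : W → ℕ)
    (hδ : ∀ i, 0 < δ i) (hadd : ∀ i, ∑ b : Quiver.Star i, δ b.1 = 2 * δ i)
    (hN : ∃ i, Nontrivial (N i 0)) (s : ℕ) : ∃ i, Nontrivial (N i s) := by
  let d : ℕ → ℕ := fun s => ∑ i, δ i * Module.finrank k (N i s)
  have hsum : ∀ s, ∑ i, δ i * ∑ b : Quiver.Star i, Module.finrank k (N b.1 s) = 2 * d s := by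
    intro s
    simp only [Finset.mul_sum, d]
    rw [sum_star_comm (fun i j => δ i * Module.finrank k (N j s))]
    refine Finset.sum_congr rfl fun i _ => ?_
    rw [← Finset.sum_mul, hadd, mul_assoc]
  -- Convexity: summing the dimension inequalities with weights `δ` turns the adjacency matrix into
  -- multiplication by `2`.
  have hrec : ∀ s, 2 * d (s + 1) ≤ d (s + 2) + d s := by
    intro s
    rw [← hsum, ← Finset.sum_add_distrib]
    refine Finset.sum_le_sum fun i _ => ?_
    rw [← mul_add]
    exact Nat.mul_le_mul_left _ (h.sum_finrank_le i s)
  have hone : 2 * d 0 ≤ d 1 := by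
    rw [← hsum]
    exact Finset.sum_le_sum fun i _ => Nat.mul_le_mul_left _ (h.sum_finrank_zero_le i)
  have hpos : 0 < d 0 := by
    obtain ⟨i, hi⟩ := hN
    exact Finset.sum_pos' (fun _ _ => Nat.zero_le _)
      ⟨i, Finset.mem_univ _, Nat.mul_pos (hδ i) Module.finrank_pos⟩
  -- The first step increases because `2 * d 0 ≤ d 1` and `d 0 > 0`; convexity propagates this.
  have hmono : ∀ s, d s < d (s + 1) := by
    intro s
    induction s with
    | zero => simp only [zero_add]; omega
    | succ s ih => have : 2 * d (s + 1) ≤ d (s + 1 + 1) + d s := hrec s; omega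
  have hds : 0 < d s := by
    cases s with
    | zero => exact hpos
    | succ s => exact (Nat.zero_le _).trans_lt (hmono s)
  obtain ⟨i, -, hi⟩ := Finset.exists_ne_zero_of_sum_ne_zero hds.ne'
  exact ⟨i, Module.nontrivial_of_finrank_pos (R := k)
    (Nat.pos_of_ne_zero (right_ne_zero_of_mul hi))⟩

/-- The recursion for the traces of an endomorphism scaling the arrows by `w`. -/
theorem trace_succ_succ (h : IsMeshModule ε act) (hs : ∀ s, HasNoSocle act s)
    (w : ∀ ⦃a b : W⦄, (a ⟶ b) → k) {l : k} (hw : ∀ ⦃a b : W⦄ (β : a ⟶ b), w β * w (reverse β) = l)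
    (G : ∀ i s, N i s →ₗ[k] N i s)
    (hG : ∀ ⦃a b : W⦄ (β : a ⟶ b) s y, G a (s + 1) (act β s y) = w β • act β s (G b s y))
    (i : W) (s : ℕ) :
    LinearMap.trace k _ (G i (s + 2)) + l * LinearMap.trace k _ (G i s)
      = ∑ b : Quiver.Star i, w b.2 * LinearMap.trace k _ (G b.1 (s + 1)) := by
  let p : (∀ b : Quiver.Star i, N b.1 (s + 1)) →ₗ[k] N i (s + 2) :=
    ∑ b : Quiver.Star i, act b.2 (s + 1) ∘ₗ LinearMap.proj b
  let q : N i s →ₗ[k] (∀ b : Quiver.Star i, N b.1 (s + 1)) :=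
    LinearMap.pi fun b => ε b.2 • act (reverse b.2) s
  have hp : ∀ x, p x = ∑ b : Quiver.Star i, act b.2 (s + 1) (x b) := fun x => by
    simp [p, LinearMap.sum_apply]
  have hq : ∀ y b, q y b = ε b.2 • act (reverse b.2) s y := fun y b => rfl
  have key := LinearMap.trace_eq_add_of_shortExact q p
    (by
      refine LinearMap.ker_eq_bot.1 (LinearMap.ker_eq_bot'.2 fun y hy => hs s i y fun b => ?_)
      exact (smul_eq_zero.1 (congrFun hy b)).resolve_left (h.sign_ne_zero _))
    (fun x => by
      obtain ⟨y, hy⟩ := h.surjective i (s + 1) x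
      exact ⟨y, by rw [hp, hy]⟩)
    (fun y => by
      rw [hp, ← h.mesh i s y]
      exact Finset.sum_congr rfl fun b _ => by rw [hq, map_smul])
    (fun x hx => by
      obtain ⟨y, hy⟩ := h.exact_succ i s x (by rw [← hp, hx])
      exact ⟨y, funext fun b => (hy b).symm⟩)
    -- The factor `l` on the left term is the weight of `β` on the middle summand times the weight
    -- of `β*` picked up by the map `q`.
    (l • G i s) (LinearMap.pi fun b => (w b.2 • G b.1 (s + 1)) ∘ₗ LinearMap.proj b)
    (G i (s + 2))
    (fun y => by
      funext b
      simp only [LinearMap.pi_apply, LinearMap.comp_apply, LinearMap.proj_apply,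
        LinearMap.smul_apply, hq, map_smul, hG, smul_smul, ← hw b.2])
    (fun x => by
      rw [hp, hp, map_sum]
      refine Finset.sum_congr rfl fun b _ => ?_
      rw [hG]
      simp)
  rw [LinearMap.trace_pi_eq_sum (fun b : Quiver.Star i => w b.2 • G b.1 (s + 1))] at key
  simp only [map_smul, smul_eq_mul] at key
  rw [key, add_comm]

/-- There is no mesh relation below degree `2`, so degree `1` is isomorphic to the sum of the degree
`0` spaces and the recursion has no term with `l`. -/
theorem trace_one (h : IsMeshModule ε act)
    (w : ∀ ⦃a b : W⦄, (a ⟶ b) → k) (G : ∀ i s, N i s →ₗ[k] N i s)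
    (hG : ∀ ⦃a b : W⦄ (β : a ⟶ b) s y, G a (s + 1) (act β s y) = w β • act β s (G b s y))
    (i : W) :
    LinearMap.trace k _ (G i 1) = ∑ b : Quiver.Star i, w b.2 * LinearMap.trace k _ (G b.1 0) := by
  let p : (∀ b : Quiver.Star i, N b.1 0) →ₗ[k] N i 1 :=
    ∑ b : Quiver.Star i, act b.2 0 ∘ₗ LinearMap.proj b
  have hp : ∀ x, p x = ∑ b : Quiver.Star i, act b.2 0 (x b) := fun x => by
    simp [p, LinearMap.sum_apply]
  let e : (∀ b : Quiver.Star i, N b.1 0) ≃ₗ[k] N i 1 := LinearEquiv.ofBijective p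
    ⟨LinearMap.ker_eq_bot.1 (LinearMap.ker_eq_bot'.2 fun x hx =>
      h.exact_zero i x (by rw [← hp, hx])), fun x => by
      obtain ⟨y, hy⟩ := h.surjective i 0 x
      exact ⟨y, by rw [hp, hy]⟩⟩
  have he : G i 1 = e.conj (LinearMap.pi fun b : Quiver.Star i => (w b.2 • G b.1 0) ∘ₗ LinearMap.proj b) := by
    ext x
    obtain ⟨y, rfl⟩ := e.surjective x
    rw [LinearEquiv.conj_apply_apply, e.symm_apply_apply]
    change G i 1 (p y) = p _
    rw [hp, hp, map_sum]
    refine Finset.sum_congr rfl fun b _ => ?_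
    rw [hG]
    simp
  rw [he, LinearMap.trace_conj', LinearMap.trace_pi_eq_sum (fun b : Quiver.Star i => w b.2 • G b.1 0)]
  simp

end IsMeshModule

end MeshModule

/-! ### Path algebras: grading and division by arrows -/

namespace Quiver.Path

variable {V : Type*} [Quiver V]

/-- The first arrow of a path together with the remaining path, if the path is not trivial. -/
def uncons {a : V} : ∀ {b : V}, Path a b → Option (Σ c : V, (a ⟶ c) × Path c b)
  | _, nil => none
  | _, cons nil e => some ⟨_, e, nil⟩
  | _, cons (cons p f) e => (uncons (cons p f)).map fun x => ⟨x.1, x.2.1, x.2.2.cons e⟩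

theorem uncons_toPath_comp {a b c : V} (e : a ⟶ b) (q : Path b c) :
    uncons (e.toPath.comp q) = some ⟨b, e, q⟩ := by
  induction q with
  | nil => rfl
  | cons q f ih =>
    have hne : ∃ (d : V) (p : Path a d) (g : d ⟶ _), e.toPath.comp q = p.cons g := by
      cases q with
      | nil => exact ⟨_, nil, e, rfl⟩
      | cons q g => exact ⟨_, e.toPath.comp q, g, rfl⟩
    obtain ⟨d, p, g, hp⟩ := hne
    rw [hp] at ih
    rw [comp_cons, hp, uncons, ih]
    rfl

end Quiver.Path

namespace PathAlgebra

variable {k V : Type*} [Field k] [Quiver V]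

/-- The linear map out of the path algebra with prescribed values on paths. -/
noncomputable def liftLinear {M : Type*} [AddCommGroup M] [Module k M]
    (f : ∀ ⦃a b : V⦄, Path a b → M) : PathAlgebra k V →ₗ[k] M :=
  Finsupp.lift M k (AllPaths V) fun p => f p.2.2

theorem liftLinear_ofPath {M : Type*} [AddCommGroup M] [Module k M]
    (f : ∀ ⦃a b : V⦄, Path a b → M) {a b : V} (p : Path a b) :
    liftLinear f (ofPath k p) = f p := by
  unfold liftLinear ofPath
  erw [Finsupp.lift_apply, Finsupp.sum_single_index, one_smul]
  exact zero_smul _ _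

theorem linearMap_ext {M : Type*} [AddCommGroup M] [Module k M] {f g : PathAlgebra k V →ₗ[k] M}
    (h : ∀ ⦃a b : V⦄ (p : Path a b), f (ofPath k p) = g (ofPath k p)) : f = g := by
  ext x
  refine induction_on (P := fun x => f x = g x) x (by simp)
    (fun x y hx hy => by simp [hx, hy]) fun r a b p => by simp [h]

variable (k V) in
/-- The projection onto the degree `s` piece. -/
noncomputable def proj (s : ℕ) : PathAlgebra k V →ₗ[k] PathAlgebra k V :=
  liftLinear fun _ _ p => if p.length = s then ofPath k p else 0

theorem proj_ofPath {a b : V} (p : Path a b) (s : ℕ) :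
    proj k V s (ofPath k p) = if p.length = s then ofPath k p else 0 :=
  liftLinear_ofPath _ p

theorem proj_eq_self_of_mem {s : ℕ} {x : PathAlgebra k V} (hx : x ∈ piece k V s) :
    proj k V s x = x := by
  refine Submodule.span_induction ?_ (by simp) (fun x y _ _ hx hy => by rw [map_add, hx, hy])
    (fun r x _ hx => by rw [map_smul, hx]) hx
  rintro _ ⟨a, b, p, hp, rfl⟩
  rw [proj_ofPath, if_pos hp]

theorem proj_mem (s : ℕ) (x : PathAlgebra k V) : proj k V s x ∈ piece k V s := by
  refine induction_on (P := fun x => proj k V s x ∈ piece k V s) x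
    (by simp) (fun x y hx hy => by rw [map_add]; exact add_mem hx hy) fun r a b p => ?_
  rw [map_smul, proj_ofPath]
  refine Submodule.smul_mem _ _ ?_
  split_ifs with h
  · exact Submodule.subset_span ⟨a, b, p, h, rfl⟩
  · exact zero_mem _

theorem nil_mul_ofPath {a b : V} (p : Path a b) :
    ofPath k (Path.nil : Path a a) * ofPath k p = ofPath k p := by
  rw [ofPath_mul_ofPath, Path.nil_comp]

theorem ofPath_mul_nil {a b : V} (p : Path a b) :
    ofPath k p * ofPath k (Path.nil : Path b b) = ofPath k p := by
  rw [ofPath_mul_ofPath, Path.comp_nil]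

variable [Fintype V]

theorem proj_ofPath_mul {a b : V} (p : Path a b) (s : ℕ) (x : PathAlgebra k V) :
    proj k V (p.length + s) (ofPath k p * x) = ofPath k p * proj k V s x := by
  suffices proj k V (p.length + s) ∘ₗ LinearMap.mulLeft k (ofPath k p)
      = LinearMap.mulLeft k (ofPath k p) ∘ₗ proj k V s from LinearMap.congr_fun this x
  refine linearMap_ext fun c d q => ?_
  simp only [LinearMap.comp_apply, LinearMap.mulLeft_apply, proj_ofPath]
  by_cases h : b = c
  · subst h
    rw [ofPath_mul_ofPath, proj_ofPath, Path.length_comp]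
    simp only [add_right_inj]
    split_ifs
    · rw [ofPath_mul_ofPath]
    · rw [mul_zero]
  · rw [ofPath_mul_ofPath_of_ne _ _ h, map_zero]
    split_ifs
    · rw [ofPath_mul_ofPath_of_ne _ _ h]
    · rw [mul_zero]

theorem proj_ofPath_mul_of_lt {a b : V} (p : Path a b) {s : ℕ} (hs : s < p.length)
    (x : PathAlgebra k V) : proj k V s (ofPath k p * x) = 0 := by
  suffices proj k V s ∘ₗ LinearMap.mulLeft k (ofPath k p) = 0 from LinearMap.congr_fun this x
  refine linearMap_ext fun c d q => ?_
  simp only [LinearMap.comp_apply, LinearMap.mulLeft_apply, LinearMap.zero_apply]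
  by_cases h : b = c
  · subst h
    rw [ofPath_mul_ofPath, proj_ofPath, Path.length_comp, if_neg (by omega)]
  · rw [ofPath_mul_ofPath_of_ne _ _ h, map_zero]

theorem proj_mul_ofPath {a b : V} (p : Path a b) (s : ℕ) (x : PathAlgebra k V) :
    proj k V (s + p.length) (x * ofPath k p) = proj k V s x * ofPath k p := by
  suffices proj k V (s + p.length) ∘ₗ LinearMap.mulRight k (ofPath k p)
      = LinearMap.mulRight k (ofPath k p) ∘ₗ proj k V s from LinearMap.congr_fun this x
  refine linearMap_ext fun c d q => ?_
  simp only [LinearMap.comp_apply, LinearMap.mulRight_apply, proj_ofPath]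
  by_cases h : d = a
  · subst h
    rw [ofPath_mul_ofPath, proj_ofPath, Path.length_comp]
    simp only [add_left_inj]
    split_ifs
    · rw [ofPath_mul_ofPath]
    · rw [zero_mul]
  · rw [ofPath_mul_ofPath_of_ne _ _ h, map_zero]
    split_ifs
    · rw [ofPath_mul_ofPath_of_ne _ _ h]
    · rw [zero_mul]

theorem proj_mul_ofPath_of_lt {a b : V} (p : Path a b) {s : ℕ} (hs : s < p.length)
    (x : PathAlgebra k V) : proj k V s (x * ofPath k p) = 0 := by
  suffices proj k V s ∘ₗ LinearMap.mulRight k (ofPath k p) = 0 from LinearMap.congr_fun this x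
  refine linearMap_ext fun c d q => ?_
  simp only [LinearMap.comp_apply, LinearMap.mulRight_apply, LinearMap.zero_apply]
  by_cases h : d = a
  · subst h
    rw [ofPath_mul_ofPath, proj_ofPath, Path.length_comp, if_neg (by omega)]
  · rw [ofPath_mul_ofPath_of_ne _ _ h, map_zero]

open Classical in
/-- Left division by an arrow: paths starting with that arrow lose it, other paths go to `0`. -/
noncomputable def leftDiv (b : Σ a : V, Quiver.Star a) : PathAlgebra k V →ₗ[k] PathAlgebra k V :=
  liftLinear fun a _ p => p.uncons.elim 0 fun x =>
    if (⟨a, x.1, x.2.1⟩ : Σ a : V, Quiver.Star a) = b then ofPath k x.2.2 else 0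

-- The trivial path in the result is needed because `x` may contain paths not starting at the target
-- of the arrow; these are lost in the product.
open Classical in
theorem leftDiv_arrow_mul (b c : Σ a : V, Quiver.Star a) (x : PathAlgebra k V) :
    leftDiv b (ofPath k c.2.2.toPath * x)
      = if c = b then ofPath k (Path.nil : Path c.2.1 c.2.1) * x else 0 := by
  suffices leftDiv b ∘ₗ LinearMap.mulLeft k (ofPath k c.2.2.toPath)
      = if c = b then LinearMap.mulLeft k (ofPath k (Path.nil : Path c.2.1 c.2.1)) else 0 by
    have h := LinearMap.congr_fun this x
    split_ifs at h ⊢ <;> exact h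
  obtain ⟨a, d, β⟩ := c
  refine linearMap_ext fun e f q => ?_
  simp only [LinearMap.comp_apply, LinearMap.mulLeft_apply]
  by_cases h : d = e
  · subst h
    rw [ofPath_mul_ofPath, leftDiv, liftLinear_ofPath, Path.uncons_toPath_comp]
    simp only [Option.elim_some]
    split_ifs
    · rw [LinearMap.mulLeft_apply, nil_mul_ofPath]
    · rfl
  · rw [ofPath_mul_ofPath_of_ne _ _ h, map_zero]
    split_ifs
    · rw [LinearMap.mulLeft_apply, ofPath_mul_ofPath_of_ne _ _ h]
    · rfl

end PathAlgebra

/-! ### The preprojective relation -/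

instance Quiver.Symmetrify.fintypeHom {V : Type*} [Quiver V] [∀ a b : V, Fintype (a ⟶ b)]
    (a b : Symmetrify V) : Fintype (a ⟶ b) :=
  inferInstanceAs (Fintype (((show V from a) ⟶ (show V from b)) ⊕
    ((show V from b) ⟶ (show V from a))))

/-- A function on the arrows of the double given by its values on the arrows and on the opposite
arrows of a quiver. -/
def doubleElim {V R : Type*} [Quiver V] (c t : ∀ ⦃a b : V⦄, (a ⟶ b) → R) :
    ∀ ⦃a b : Symmetrify V⦄, (a ⟶ b) → R :=
  fun _ _ β => Sum.elim (fun α => c α) (fun α => t α) β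

/-- The sign of an arrow of the double. -/
def doubleSign (k V : Type*) [Field k] [Quiver V] : ∀ ⦃a b : Symmetrify V⦄, (a ⟶ b) → k :=
  doubleElim (fun _ _ _ => 1) fun _ _ _ => -1

theorem doubleSign_ne_zero {k V : Type*} [Field k] [Quiver V] {a b : Symmetrify V} (β : a ⟶ b) :
    doubleSign k V β ≠ 0 := by
  rcases β with α | α
  · exact one_ne_zero
  · exact neg_ne_zero.2 one_ne_zero

section

variable {k V : Type*} [Field k] [Quiver V] [Fintype V] [∀ a b : V, Fintype (a ⟶ b)]

open PathAlgebra

/-- Indexing by all arrows of the double, with a sign, treats `α` and `α*` alike, so that later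
arguments need no case distinction. -/
theorem preprojectiveRelation_eq_sum :
    preprojectiveRelation k V = ∑ x : (Σ a : Symmetrify V, Quiver.Star a),
      doubleSign k V x.2.2 • (ofPath k x.2.2.toPath * ofPath k (reverse x.2.2).toPath) := by
  rw [Fintype.sum_sigma]
  simp_rw [Fintype.sum_sigma]
  have h : ∀ a b : V, ∑ β : (show Symmetrify V from a) ⟶ (show Symmetrify V from b),
      doubleSign k V β • (ofPath k β.toPath * ofPath k (reverse β).toPath)
      = ∑ α : a ⟶ b, ofPath k (Hom.toPos α).toPath * ofPath k (Hom.toNeg α).toPath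
        - ∑ α : b ⟶ a, ofPath k (Hom.toNeg α).toPath * ofPath k (Hom.toPos α).toPath := by
    intro a b
    refine (Fintype.sum_sum_type _).trans ?_
    rw [sub_eq_add_neg, ← Finset.sum_neg_distrib]
    refine congrArg₂ _ (Finset.sum_congr rfl fun α _ => one_smul _ _)
      (Finset.sum_congr rfl fun α _ => ?_)
    exact (neg_smul _ _).trans (by rw [one_smul]; rfl)
  refine Eq.trans ?_ (Finset.sum_congr rfl fun (a : V) _ =>
    Finset.sum_congr rfl fun (b : V) _ => (h a b).symm)
  have hcomm := Finset.sum_comm (s := (Finset.univ : Finset V)) (t := (Finset.univ : Finset V))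
    (f := fun a b => ∑ α : b ⟶ a, ofPath k (Hom.toNeg α).toPath * ofPath k (Hom.toPos α).toPath)
  have hdist : ∀ F G : V → V → PathAlgebra k (Symmetrify V),
      ∑ a, ∑ b, (F a b - G a b) = ∑ a, ∑ b, F a b - ∑ a, ∑ b, G a b := fun F G => by
    simp_rw [Finset.sum_sub_distrib]
  refine Eq.trans ?_ (hdist _ _).symm
  refine Eq.trans ?_ (congrArg _ hcomm.symm)
  rw [← hdist]
  unfold preprojectiveRelation
  simp_rw [Finset.sum_sub_distrib]

theorem preprojectiveRelation_mem : preprojectiveRelation k V ∈ preprojectiveIdeal k V :=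
  TwoSidedIdeal.subset_span rfl

theorem nil_mul_preprojectiveRelation (i : Symmetrify V) :
    ofPath k (Path.nil : Path i i) * preprojectiveRelation k V
      = ∑ b : Quiver.Star i, doubleSign k V b.2 •
        (ofPath k b.2.toPath * ofPath k (reverse b.2).toPath) := by
  rw [preprojectiveRelation_eq_sum, Fintype.sum_sigma, Finset.mul_sum, Finset.sum_eq_single i]
  · rw [Finset.mul_sum]
    refine Finset.sum_congr rfl fun b _ => ?_
    rw [mul_smul_comm, ← mul_assoc, nil_mul_ofPath]
  · intro j _ hj
    rw [Finset.mul_sum]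
    refine Finset.sum_eq_zero fun b _ => ?_
    rw [mul_smul_comm, ← mul_assoc, ofPath_mul_ofPath_of_ne _ _ hj.symm, zero_mul, smul_zero]
  · simp

/-- Each summand is a closed path, so the relation commutes with all trivial paths. This is why,
modulo left multiples of arrows, the two-sided ideal reduces to right multiples of the relation. -/
theorem preprojectiveRelation_mul_nil (i : Symmetrify V) :
    preprojectiveRelation k V * ofPath k (Path.nil : Path i i)
      = ofPath k (Path.nil : Path i i) * preprojectiveRelation k V := by
  rw [nil_mul_preprojectiveRelation, preprojectiveRelation_eq_sum, Fintype.sum_sigma,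
    Finset.sum_mul, Finset.sum_eq_single i]
  · rw [Finset.sum_mul]
    refine Finset.sum_congr rfl fun b _ => ?_
    rw [smul_mul_assoc, mul_assoc, ofPath_mul_nil]
  · intro j _ hj
    rw [Finset.sum_mul]
    refine Finset.sum_eq_zero fun b _ => ?_
    rw [smul_mul_assoc, mul_assoc, ofPath_mul_ofPath_of_ne _ _ hj, mul_zero, smul_zero]
  · simp

theorem proj_preprojectiveRelation (s : ℕ) :
    proj k (Symmetrify V) s (preprojectiveRelation k V)
      = if s = 2 then preprojectiveRelation k V else 0 := by
  rw [preprojectiveRelation_eq_sum, map_sum]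
  have h : ∀ x : (Σ a : Symmetrify V, Quiver.Star a), proj k (Symmetrify V) s
      (doubleSign k V x.2.2 • (ofPath k x.2.2.toPath * ofPath k (reverse x.2.2).toPath))
      = if s = 2 then doubleSign k V x.2.2 •
        (ofPath k x.2.2.toPath * ofPath k (reverse x.2.2).toPath) else 0 := by
    intro x
    rw [map_smul, ofPath_mul_ofPath, proj_ofPath, Path.length_comp, Path.length_toPath,
      Path.length_toPath, smul_ite, smul_zero]
    simp only [Nat.reduceAdd, eq_comm]
  simp_rw [h]
  split_ifs
  · rfl
  · simp

/-! ### Homogeneity of the ideal and linear relations modulo it -/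

theorem smul_mem_preprojectiveIdeal (r : k) {x : PathAlgebra k (Symmetrify V)}
    (hx : x ∈ preprojectiveIdeal k V) : r • x ∈ preprojectiveIdeal k V := by
  have := (preprojectiveIdeal k V).mul_mem_left (algebraMap k _ r) _ hx
  rwa [← Algebra.smul_def] at this

theorem sum_mem_preprojectiveIdeal {ι : Type*} (s : Finset ι)
    {x : ι → PathAlgebra k (Symmetrify V)} (hx : ∀ b ∈ s, x b ∈ preprojectiveIdeal k V) :
    ∑ b ∈ s, x b ∈ preprojectiveIdeal k V :=
  by
  classical
  induction s using Finset.induction_on with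
  | empty => exact zero_mem _
  | insert b s hb ih =>
    rw [Finset.sum_insert hb]
    exact add_mem (hx b (Finset.mem_insert_self _ _))
      (ih fun c hc => hx c (Finset.mem_insert_of_mem hc))

/-- The preprojective ideal is homogeneous. -/
theorem proj_mem_preprojectiveIdeal {x : PathAlgebra k (Symmetrify V)}
    (hx : x ∈ preprojectiveIdeal k V) (s : ℕ) :
    proj k (Symmetrify V) s x ∈ preprojectiveIdeal k V := by
  unfold preprojectiveIdeal at hx
  induction hx using TwoSidedIdeal.span_induction generalizing s with
  | mem x h =>
    rw [Set.mem_singleton_iff.1 h, proj_preprojectiveRelation]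
    split_ifs
    · exact preprojectiveRelation_mem
    · exact zero_mem _
  | zero => rw [map_zero]; exact zero_mem _
  | add x y _ _ hx hy => rw [map_add]; exact add_mem (hx s) (hy s)
  | neg x _ hx => rw [map_neg]; exact neg_mem (hx s)
  | left_absorb a x _ hx =>
    refine induction_on (P := fun a => proj k (Symmetrify V) s (a * x) ∈ preprojectiveIdeal k V) a
      (by rw [zero_mul, map_zero]; exact zero_mem _)
      (fun a b ha hb => by rw [add_mul, map_add]; exact add_mem ha hb) fun r b c p => ?_
    rw [smul_mul_assoc, map_smul]
    refine smul_mem_preprojectiveIdeal _ ?_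
    rcases lt_or_ge s p.length with h | h
    · rw [proj_ofPath_mul_of_lt p h]
      exact zero_mem _
    · obtain ⟨m, rfl⟩ := Nat.exists_eq_add_of_le h
      rw [proj_ofPath_mul]
      exact TwoSidedIdeal.mul_mem_left _ _ _ (hx m)
  | right_absorb a x _ hx =>
    refine induction_on (P := fun a => proj k (Symmetrify V) s (x * a) ∈ preprojectiveIdeal k V) a
      (by rw [mul_zero, map_zero]; exact zero_mem _)
      (fun a b ha hb => by rw [mul_add, map_add]; exact add_mem ha hb) fun r b c p => ?_
    rw [mul_smul_comm, map_smul]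
    refine smul_mem_preprojectiveIdeal _ ?_
    rcases lt_or_ge s p.length with h | h
    · rw [proj_mul_ofPath_of_lt p h]
      exact zero_mem _
    · obtain ⟨m, rfl⟩ := Nat.exists_eq_add_of_le' h
      rw [proj_mul_ofPath]
      exact TwoSidedIdeal.mul_mem_right _ _ _ (hx m)

/-- An element of the preprojective ideal is a right multiple of the relation up to left multiples
of elements of the ideal by arrows. -/
theorem exists_eq_of_mem_preprojectiveIdeal {x : PathAlgebra k (Symmetrify V)}
    (hx : x ∈ preprojectiveIdeal k V) :
    ∃ (y : PathAlgebra k (Symmetrify V))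
      (z : (Σ a : Symmetrify V, Quiver.Star a) → PathAlgebra k (Symmetrify V)),
      (∀ b, z b ∈ preprojectiveIdeal k V) ∧
      x = preprojectiveRelation k V * y + ∑ b, ofPath k b.2.2.toPath * z b := by
  classical
  have hadd : ∀ {x₁ x₂ : PathAlgebra k (Symmetrify V)},
      (∃ (y : PathAlgebra k (Symmetrify V))
        (z : (Σ a : Symmetrify V, Quiver.Star a) → PathAlgebra k (Symmetrify V)),
        (∀ b, z b ∈ preprojectiveIdeal k V) ∧
        x₁ = preprojectiveRelation k V * y + ∑ b, ofPath k b.2.2.toPath * z b) →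
      (∃ (y : PathAlgebra k (Symmetrify V))
        (z : (Σ a : Symmetrify V, Quiver.Star a) → PathAlgebra k (Symmetrify V)),
        (∀ b, z b ∈ preprojectiveIdeal k V) ∧
        x₂ = preprojectiveRelation k V * y + ∑ b, ofPath k b.2.2.toPath * z b) →
      (∃ (y : PathAlgebra k (Symmetrify V))
        (z : (Σ a : Symmetrify V, Quiver.Star a) → PathAlgebra k (Symmetrify V)),
        (∀ b, z b ∈ preprojectiveIdeal k V) ∧
        x₁ + x₂ = preprojectiveRelation k V * y + ∑ b, ofPath k b.2.2.toPath * z b) := by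
    rintro x₁ x₂ ⟨y₁, z₁, hz₁, rfl⟩ ⟨y₂, z₂, hz₂, rfl⟩
    refine ⟨y₁ + y₂, z₁ + z₂, fun b => add_mem (hz₁ b) (hz₂ b), ?_⟩
    simp only [mul_add, Pi.add_apply, Finset.sum_add_distrib]
    abel
  unfold preprojectiveIdeal at hx
  induction hx using TwoSidedIdeal.span_induction with
  | mem x h =>
    refine ⟨1, 0, fun b => zero_mem _, ?_⟩
    simp [Set.mem_singleton_iff.1 h]
  | zero => exact ⟨0, 0, fun b => zero_mem _, by simp⟩
  | add x y _ _ hx hy => exact hadd hx hy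
  | neg x _ hx =>
    obtain ⟨y, z, hz, rfl⟩ := hx
    exact ⟨-y, -z, fun b => neg_mem (hz b), by simp [add_comm]⟩
  | left_absorb a x hx' hx =>
    refine induction_on (P := fun a => ∃ (y : PathAlgebra k (Symmetrify V))
      (z : (Σ a : Symmetrify V, Quiver.Star a) → PathAlgebra k (Symmetrify V)),
      (∀ b, z b ∈ preprojectiveIdeal k V) ∧
      a * x = preprojectiveRelation k V * y + ∑ b, ofPath k b.2.2.toPath * z b) a
      ⟨0, 0, fun b => zero_mem _, by simp⟩
      (fun a b ha hb => by rw [add_mul]; exact hadd ha hb) fun r i j p => ?_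
    by_cases hp : p.length = 0
    · obtain rfl := Path.eq_of_length_zero p hp
      obtain rfl := Path.eq_nil_of_length_zero p hp
      obtain ⟨y, z, hz, rfl⟩ := hx
      -- A trivial path passes through the relation and selects, among the arrow terms, those
      -- starting at `i`.
      refine ⟨r • (ofPath k (Path.nil : Path i i) * y), fun b => if b.1 = i then r • z b else 0,
        fun b => ?_, ?_⟩
      · dsimp only
        split_ifs
        · exact smul_mem_preprojectiveIdeal _ (hz b)
        · exact zero_mem _
      · rw [smul_mul_assoc, mul_add, smul_add, mul_smul_comm, ← mul_assoc, ← mul_assoc,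
          preprojectiveRelation_mul_nil, Finset.mul_sum, Finset.smul_sum]
        congr 1
        refine Finset.sum_congr rfl fun b _ => ?_
        rw [← mul_assoc]
        dsimp only
        split_ifs with h
        · subst h
          rw [nil_mul_ofPath, mul_smul_comm]
        · rw [ofPath_mul_ofPath_of_ne _ _ (Ne.symm h), zero_mul, smul_zero, mul_zero]
    -- A path of positive length begins with an arrow `e`, so the whole product is `e` times an
    -- element of the ideal and `y` can be taken to be `0`.
    · obtain ⟨c, e, q, rfl, -⟩ := (Path.length_ne_zero_iff_eq_comp p).1 hp
      refine ⟨0, Pi.single ⟨i, c, e⟩ (r • (ofPath k q * x)), fun b => ?_, ?_⟩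
      · rcases eq_or_ne b ⟨i, c, e⟩ with rfl | hb
        · rw [Pi.single_eq_same]
          exact smul_mem_preprojectiveIdeal _ (TwoSidedIdeal.mul_mem_left _ _ _ hx')
        · rw [Pi.single_eq_of_ne hb]
          exact zero_mem _
      · rw [mul_zero, zero_add, Finset.sum_eq_single ⟨i, c, e⟩]
        · rw [Pi.single_eq_same, ← ofPath_mul_ofPath, smul_mul_assoc, mul_smul_comm, mul_assoc]
        · intro b _ hb
          rw [Pi.single_eq_of_ne hb, mul_zero]
        · simp
  | right_absorb a x _ hx =>
    obtain ⟨y, z, hz, rfl⟩ := hx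
    refine ⟨y * a, fun b => z b * a, fun b => TwoSidedIdeal.mul_mem_right _ _ _ (hz b), ?_⟩
    simp only [add_mul, mul_assoc, Finset.sum_mul]

/-- Both kinds of terms in the normal form begin with an arrow. Consequently the idempotents survive
in the quotient. -/
theorem proj_zero_of_mem_preprojectiveIdeal {x : PathAlgebra k (Symmetrify V)}
    (hx : x ∈ preprojectiveIdeal k V) : proj k (Symmetrify V) 0 x = 0 := by
  obtain ⟨y, z, -, rfl⟩ := exists_eq_of_mem_preprojectiveIdeal hx
  rw [preprojectiveRelation_eq_sum, Finset.sum_mul, map_add, map_sum, map_sum,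
    Finset.sum_eq_zero, Finset.sum_eq_zero, add_zero]
  · intro b _
    exact proj_ofPath_mul_of_lt _ Nat.zero_lt_one _
  · intro b _
    rw [smul_mul_assoc, map_smul, mul_assoc, proj_ofPath_mul_of_lt _ Nat.zero_lt_one, smul_zero]

/-- Linear relations between left multiples of arrows modulo the preprojective ideal. -/
theorem exists_eq_of_sum_mem_preprojectiveIdeal {i : Symmetrify V}
    (x : Quiver.Star i → PathAlgebra k (Symmetrify V))
    (hx : ∀ b : Quiver.Star i, ofPath k (Path.nil : Path b.1 b.1) * x b = x b)
    (hmem : ∑ b : Quiver.Star i, ofPath k b.2.toPath * x b ∈ preprojectiveIdeal k V) :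
    ∃ y, ∀ b : Quiver.Star i, x b - doubleSign k V b.2 • (ofPath k (reverse b.2).toPath * y)
      ∈ preprojectiveIdeal k V := by
  classical
  obtain ⟨y, z, hz, h⟩ := exists_eq_of_mem_preprojectiveIdeal hmem
  refine ⟨y, fun b => ?_⟩
  -- Division by the arrow `b` isolates `x b` on one side; on the other it leaves the `b`-component
  -- of the relation times `y` and an error in the ideal.
  have h' := congrArg (leftDiv ⟨i, b⟩) h
  rw [map_sum, map_add, preprojectiveRelation_eq_sum, Finset.sum_mul, map_sum, map_sum] at h'
  have h₁ : ∑ c : Quiver.Star i, leftDiv ⟨i, b⟩ (ofPath k c.2.toPath * x c) = x b := by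
    rw [Finset.sum_eq_single b]
    · rw [leftDiv_arrow_mul ⟨i, b⟩ ⟨i, b⟩, if_pos rfl, hx]
    · intro c _ hc
      rw [leftDiv_arrow_mul ⟨i, b⟩ ⟨i, c⟩, if_neg]
      simpa using hc
    · simp
  have h₂ : ∑ c : (Σ a : Symmetrify V, Quiver.Star a), leftDiv ⟨i, b⟩ ((doubleSign k V c.2.2 •
      (ofPath k c.2.2.toPath * ofPath k (reverse c.2.2).toPath)) * y)
      = doubleSign k V b.2 • (ofPath k (reverse b.2).toPath * y) := by
    rw [Finset.sum_eq_single ⟨i, b⟩]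
    · rw [smul_mul_assoc, mul_assoc, map_smul, leftDiv_arrow_mul ⟨i, b⟩ ⟨i, b⟩, if_pos rfl,
        ← mul_assoc, nil_mul_ofPath]
    · intro c _ hc
      rw [smul_mul_assoc, mul_assoc, map_smul, leftDiv_arrow_mul, if_neg hc, smul_zero]
    · simp
  have h₃ : ∑ c : (Σ a : Symmetrify V, Quiver.Star a),
      leftDiv ⟨i, b⟩ (ofPath k c.2.2.toPath * z c) ∈ preprojectiveIdeal k V := by
    refine sum_mem_preprojectiveIdeal _ fun c _ => ?_
    rw [leftDiv_arrow_mul]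
    split_ifs
    · exact TwoSidedIdeal.mul_mem_left _ _ _ (hz c)
    · exact zero_mem _
  rw [h₁, h₂] at h'
  rw [h', add_sub_cancel_left]
  exact h₃

end

/-! ### The preprojective algebra as a mesh module -/

namespace PreprojectiveAlgebra

variable {k V : Type*} [Field k] [Quiver V] [Fintype V] [∀ a b : V, Fintype (a ⟶ b)]

variable (k) in
/-- The idempotent at a vertex of the double. -/
noncomputable def vertex (i : Symmetrify V) : PreprojectiveAlgebra k V :=
  ofPath k (Path.nil : Path i i)

theorem ofPath_def {a b : Symmetrify V} (p : Path a b) : ofPath k p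
    = Ideal.Quotient.mkₐ k (preprojectiveIdeal k V).asIdeal (PathAlgebra.ofPath k p) := rfl

theorem mkₐ_eq_zero_iff {x : PathAlgebra k (Symmetrify V)} :
    Ideal.Quotient.mkₐ k (preprojectiveIdeal k V).asIdeal x = 0 ↔ x ∈ preprojectiveIdeal k V := by
  rw [Ideal.Quotient.mkₐ_eq_mk, Ideal.Quotient.eq_zero_iff_mem, TwoSidedIdeal.mem_asIdeal]

theorem ofPath_mul_ofPath {a b c : Symmetrify V} (p : Path a b) (q : Path b c) :
    ofPath k p * ofPath k q = ofPath k (p.comp q) := by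
  rw [ofPath_def, ofPath_def, ← map_mul, PathAlgebra.ofPath_mul_ofPath, ofPath_def]

theorem ofPath_mul_ofPath_of_ne {a b c d : Symmetrify V} (p : Path a b) (q : Path c d)
    (h : b ≠ c) : ofPath k p * ofPath k q = 0 := by
  rw [ofPath_def, ofPath_def, ← map_mul, PathAlgebra.ofPath_mul_ofPath_of_ne _ _ h, map_zero]

theorem vertex_mul_ofPath {a b : Symmetrify V} (p : Path a b) :
    vertex k a * ofPath k p = ofPath k p := by
  rw [vertex, ofPath_mul_ofPath, Path.nil_comp]

theorem ofPath_mul_vertex {a b : Symmetrify V} (p : Path a b) :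
    ofPath k p * vertex k b = ofPath k p := by
  rw [vertex, ofPath_mul_ofPath, Path.comp_nil]

theorem vertex_mul_vertex (i : Symmetrify V) : vertex k i * vertex k i = vertex k i :=
  vertex_mul_ofPath _

theorem vertex_mul_vertex_of_ne {i j : Symmetrify V} (h : i ≠ j) : vertex k i * vertex k j = 0 :=
  ofPath_mul_ofPath_of_ne _ _ h

theorem sum_vertex : ∑ i : Symmetrify V, vertex k i = 1 := by
  rw [← map_one (Ideal.Quotient.mkₐ k (preprojectiveIdeal k V).asIdeal), PathAlgebra.one_def,
    map_sum]
  rfl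

theorem mem_piece_iff {s : ℕ} {x : PreprojectiveAlgebra k V} :
    x ∈ piece k V s ↔ ∃ y, PathAlgebra.proj k (Symmetrify V) s y = y ∧
      Ideal.Quotient.mkₐ k (preprojectiveIdeal k V).asIdeal y = x := by
  constructor
  · rintro ⟨y, hy, rfl⟩
    exact ⟨y, PathAlgebra.proj_eq_self_of_mem hy, rfl⟩
  · rintro ⟨y, hy, rfl⟩
    refine ⟨y, ?_, rfl⟩
    rw [SetLike.mem_coe, ← hy]
    exact PathAlgebra.proj_mem s y

theorem piece_induction {s : ℕ} {P : PreprojectiveAlgebra k V → Prop}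
    (h0 : P 0) (hadd : ∀ x y, P x → P y → P (x + y)) (hsmul : ∀ (r : k) x, P x → P (r • x))
    (hP : ∀ ⦃a b : Symmetrify V⦄ (p : Path a b), p.length = s → P (ofPath k p))
    {x : PreprojectiveAlgebra k V} (hx : x ∈ piece k V s) : P x := by
  obtain ⟨y, hy, rfl⟩ := hx
  refine Submodule.span_induction ?_ (by simpa using h0)
    (fun x y _ _ hx hy => by rw [map_add]; exact hadd _ _ hx hy)
    (fun r x _ hx => by rw [map_smul]; exact hsmul _ _ hx) hy
  rintro _ ⟨a, b, p, hp, rfl⟩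
  exact hP p hp

theorem ofPath_mem_piece {a b : Symmetrify V} (p : Path a b) : ofPath k p ∈ piece k V p.length :=
  ⟨_, Submodule.subset_span ⟨a, b, p, rfl, rfl⟩, rfl⟩

theorem vertex_mem_piece (i : Symmetrify V) : vertex k i ∈ piece k V 0 :=
  ofPath_mem_piece (Path.nil : Path i i)

theorem mul_mem_piece {r s : ℕ} {x y : PreprojectiveAlgebra k V} (hx : x ∈ piece k V r)
    (hy : y ∈ piece k V s) : x * y ∈ piece k V (r + s) := by
  refine piece_induction (P := fun x => x * y ∈ piece k V (r + s))
    (by rw [zero_mul]; exact zero_mem _)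
    (fun a b ha hb => by rw [add_mul]; exact add_mem ha hb)
    (fun t a ha => by rw [smul_mul_assoc]; exact Submodule.smul_mem _ _ ha) ?_ hx
  intro a b p hp
  refine piece_induction (P := fun y => ofPath k p * y ∈ piece k V (r + s))
    (by rw [mul_zero]; exact zero_mem _)
    (fun a b ha hb => by rw [mul_add]; exact add_mem ha hb)
    (fun t a ha => by rw [mul_smul_comm]; exact Submodule.smul_mem _ _ ha) ?_ hy
  intro c d q hq
  by_cases h : b = c
  · subst h
    rw [ofPath_mul_ofPath, ← hp, ← hq, ← Path.length_comp]
    exact ofPath_mem_piece _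
  · rw [ofPath_mul_ofPath_of_ne _ _ h]
    exact zero_mem _

theorem vertex_mul_mem_piece {s : ℕ} {x : PreprojectiveAlgebra k V} (i : Symmetrify V) (hx : x ∈ piece k V s) :
    vertex k i * x ∈ piece k V s := by
  simpa using mul_mem_piece (vertex_mem_piece i) hx

theorem arrow_mul_mem_piece {s : ℕ} {x : PreprojectiveAlgebra k V} {a b : Symmetrify V}
    (β : a ⟶ b) (hx : x ∈ piece k V s) : ofPath k β.toPath * x ∈ piece k V (s + 1) := by
  have := mul_mem_piece (ofPath_mem_piece (k := k) β.toPath) hx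
  rwa [Path.length_toPath, add_comm] at this

/-- Elements of positive degree are sums of left multiples of arrows. -/
theorem exists_eq_sum_arrow_mul {s : ℕ} {x : PreprojectiveAlgebra k V}
    (hx : x ∈ piece k V (s + 1)) :
    ∃ y : (Σ a : Symmetrify V, Quiver.Star a) → PreprojectiveAlgebra k V,
      (∀ b, y b ∈ piece k V s) ∧ x = ∑ b, ofPath k b.2.2.toPath * y b := by
  classical
  refine piece_induction (P := fun x => ∃ y : (Σ a : Symmetrify V, Quiver.Star a) →
      PreprojectiveAlgebra k V, (∀ b, y b ∈ piece k V s) ∧ x = ∑ b, ofPath k b.2.2.toPath * y b)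
    ⟨0, fun _ => zero_mem _, by simp⟩ ?_ ?_ ?_ hx
  · rintro _ _ ⟨y, hy, rfl⟩ ⟨z, hz, rfl⟩
    exact ⟨y + z, fun b => add_mem (hy b) (hz b), by simp [mul_add, Finset.sum_add_distrib]⟩
  · rintro r _ ⟨y, hy, rfl⟩
    exact ⟨r • y, fun b => Submodule.smul_mem _ _ (hy b), by simp [Finset.smul_sum]⟩
  · intro a b p hp
    obtain ⟨c, e, q, rfl, hq⟩ := (Path.length_ne_zero_iff_eq_comp p).1 (by omega)
    refine ⟨Pi.single ⟨a, c, e⟩ (ofPath k q), fun d => ?_, ?_⟩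
    · rcases eq_or_ne d ⟨a, c, e⟩ with rfl | hd
      · rw [Pi.single_eq_same]
        have hs : q.length = s := by omega
        exact hs ▸ ofPath_mem_piece q
      · rw [Pi.single_eq_of_ne hd]
        exact zero_mem _
    · rw [Finset.sum_eq_single ⟨a, c, e⟩]
      · rw [Pi.single_eq_same, ofPath_mul_ofPath]
      · intro d _ hd
        rw [Pi.single_eq_of_ne hd, mul_zero]
      · simp

/-- The mesh relation at a vertex. -/
theorem sum_sign_arrow_mul_reverse (i : Symmetrify V) :
    ∑ b : Quiver.Star i, doubleSign k V b.2 •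
      (ofPath k b.2.toPath * ofPath k (reverse b.2).toPath) = 0 := by
  have h := mkₐ_eq_zero_iff.2 (TwoSidedIdeal.mul_mem_left (preprojectiveIdeal k V)
    (PathAlgebra.ofPath k (Path.nil : Path i i)) _ preprojectiveRelation_mem)
  rw [nil_mul_preprojectiveRelation, map_sum] at h
  rw [← h]
  refine Finset.sum_congr rfl fun b _ => ?_
  rw [map_smul, map_mul]
  rfl

/-- Linear relations between left multiples of the arrows starting at a vertex. -/
theorem exists_lift_of_sum_arrow_mul_eq_zero {i : Symmetrify V} {s : ℕ}
    (x : Quiver.Star i → PreprojectiveAlgebra k V) (hx : ∀ b, x b ∈ piece k V s)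
    (hx' : ∀ b : Quiver.Star i, vertex k b.1 * x b = x b)
    (h : ∑ b : Quiver.Star i, ofPath k b.2.toPath * x b = 0) :
    ∃ y : PathAlgebra k (Symmetrify V), ∀ b : Quiver.Star i,
      x b = doubleSign k V b.2 • Ideal.Quotient.mkₐ k (preprojectiveIdeal k V).asIdeal
        (PathAlgebra.proj k (Symmetrify V) s (PathAlgebra.ofPath k (reverse b.2).toPath * y)) := by
  choose X hX hXx using fun b => mem_piece_iff.1 (hx b)
  let Y : Quiver.Star i → PathAlgebra k (Symmetrify V) :=
    fun b => PathAlgebra.ofPath k (Path.nil : Path b.1 b.1) * X b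
  have hY : ∀ b, Ideal.Quotient.mkₐ k (preprojectiveIdeal k V).asIdeal (Y b) = x b := by
    intro b
    rw [map_mul, hXx]
    exact hx' b
  have hYs : ∀ b, PathAlgebra.proj k (Symmetrify V) s (Y b) = Y b := by
    intro b
    have := PathAlgebra.proj_ofPath_mul (k := k) (Path.nil : Path b.1 b.1) s (X b)
    rw [Path.length_nil, zero_add, hX] at this
    exact this
  obtain ⟨y, hy⟩ := exists_eq_of_sum_mem_preprojectiveIdeal Y
    (fun b => by rw [← mul_assoc, PathAlgebra.nil_mul_ofPath]) (by
      rw [← mkₐ_eq_zero_iff, map_sum, ← h]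
      refine Finset.sum_congr rfl fun b _ => ?_
      rw [map_mul, hY]
      rfl)
  refine ⟨y, fun b => ?_⟩
  -- The element `y` need not be homogeneous; homogeneity of the ideal allows the congruence to be
  -- cut down to degree `s`.
  have h₁ := proj_mem_preprojectiveIdeal (hy b) s
  rw [map_sub, hYs, ← mkₐ_eq_zero_iff, map_sub, hY, sub_eq_zero, map_smul, map_smul] at h₁
  exact h₁

theorem eq_zero_of_sum_arrow_mul_eq_zero {i : Symmetrify V}
    (x : Quiver.Star i → PreprojectiveAlgebra k V) (hx : ∀ b, x b ∈ piece k V 0)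
    (hx' : ∀ b : Quiver.Star i, vertex k b.1 * x b = x b)
    (h : ∑ b : Quiver.Star i, ofPath k b.2.toPath * x b = 0) : x = 0 := by
  obtain ⟨y, hy⟩ := exists_lift_of_sum_arrow_mul_eq_zero x hx hx' h
  funext b
  rw [hy b, PathAlgebra.proj_ofPath_mul_of_lt _ Nat.zero_lt_one, map_zero, smul_zero]
  rfl

theorem exists_of_sum_arrow_mul_eq_zero {i : Symmetrify V} {s : ℕ}
    (x : Quiver.Star i → PreprojectiveAlgebra k V) (hx : ∀ b, x b ∈ piece k V (s + 1))
    (hx' : ∀ b : Quiver.Star i, vertex k b.1 * x b = x b)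
    (h : ∑ b : Quiver.Star i, ofPath k b.2.toPath * x b = 0) :
    ∃ y ∈ piece k V s, ∀ b : Quiver.Star i,
      x b = doubleSign k V b.2 • (ofPath k (reverse b.2).toPath * y) := by
  obtain ⟨y, hy⟩ := exists_lift_of_sum_arrow_mul_eq_zero x hx hx' h
  refine ⟨_, ⟨_, PathAlgebra.proj_mem s y, rfl⟩, fun b => ?_⟩
  have h₁ := PathAlgebra.proj_ofPath_mul (k := k) (reverse b.2).toPath s y
  rw [Path.length_toPath, add_comm] at h₁
  rw [hy b, h₁, map_mul]
  rfl

theorem vertex_ne_zero (i : Symmetrify V) : vertex k i ≠ 0 := by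
  intro h
  have h₁ := proj_zero_of_mem_preprojectiveIdeal (mkₐ_eq_zero_iff.1 h)
  rw [PathAlgebra.proj_ofPath, Path.length_nil, if_pos rfl] at h₁
  exact one_ne_zero (Finsupp.single_eq_zero.1 h₁)

/-- Elements of degree `0` are linear combinations of the idempotents. -/
theorem exists_vertex_mul_eq {x : PreprojectiveAlgebra k V} (hx : x ∈ piece k V 0) :
    ∃ r : Symmetrify V → k, ∀ i, vertex k i * x = r i • vertex k i := by
  classical
  refine piece_induction (P := fun x => ∃ r : Symmetrify V → k, ∀ i, vertex k i * x = r i • vertex k i)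
    ⟨0, by simp⟩ ?_ ?_ ?_ hx
  · rintro x y ⟨r, hr⟩ ⟨r', hr'⟩
    exact ⟨r + r', fun i => by rw [mul_add, hr, hr', Pi.add_apply, add_smul]⟩
  · rintro t x ⟨r, hr⟩
    exact ⟨t • r, fun i => by rw [mul_smul_comm, hr, Pi.smul_apply, smul_assoc]⟩
  · intro a b p hp
    obtain rfl := Path.eq_of_length_zero p hp
    obtain rfl := Path.eq_nil_of_length_zero p hp
    refine ⟨Pi.single a 1, fun i => ?_⟩
    rcases eq_or_ne i a with rfl | hi
    · rw [Pi.single_eq_same, one_smul]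
      exact vertex_mul_vertex i
    · rw [Pi.single_eq_of_ne hi, zero_smul]
      exact vertex_mul_vertex_of_ne hi

/-- If `β` vanished, the family with `e_b` at `β` and `0` elsewhere would be a nontrivial linear
relation with coefficients in degree `0`. -/
theorem arrow_ne_zero {a b : Symmetrify V} (β : a ⟶ b) : ofPath k β.toPath ≠ 0 := by
  classical
  intro h
  have h₁ := eq_zero_of_sum_arrow_mul_eq_zero (k := k) (i := a)
    (Pi.single (M := fun _ => PreprojectiveAlgebra k V) ⟨b, β⟩ (vertex k b))
    (fun c => by
      rcases eq_or_ne c ⟨b, β⟩ with rfl | hc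
      · rw [Pi.single_eq_same]
        exact vertex_mem_piece b
      · rw [Pi.single_eq_of_ne hc]
        exact zero_mem _)
    (fun c => by
      rcases eq_or_ne c ⟨b, β⟩ with rfl | hc
      · rw [Pi.single_eq_same]
        exact vertex_mul_vertex b
      · rw [Pi.single_eq_of_ne hc, mul_zero])
    (by
      refine Finset.sum_eq_zero fun c _ => ?_
      rcases eq_or_ne c ⟨b, β⟩ with rfl | hc
      · rw [h, zero_mul]
      · rw [Pi.single_eq_of_ne hc, mul_zero])
  have h₂ := congrFun h₁ ⟨b, β⟩
  rw [Pi.single_eq_same] at h₂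
  exact vertex_ne_zero b h₂

/-! ### Corners -/

/-- The subspace of the elements `x` of degree `s` with `e_i x = x` and `x f = x`. -/
noncomputable def cornerPiece (f : PreprojectiveAlgebra k V) (i : Symmetrify V) (s : ℕ) :
    Submodule k (PreprojectiveAlgebra k V) where
  carrier := {x | x ∈ piece k V s ∧ vertex k i * x = x ∧ x * f = x}
  add_mem' := fun ⟨h, h₁, h₂⟩ ⟨h', h₁', h₂'⟩ =>
    ⟨add_mem h h', by rw [mul_add, h₁, h₁'], by rw [add_mul, h₂, h₂']⟩
  zero_mem' := ⟨zero_mem _, mul_zero _, zero_mul _⟩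
  smul_mem' := fun r _ ⟨h, h₁, h₂⟩ =>
    ⟨Submodule.smul_mem _ r h, by rw [mul_smul_comm, h₁], by rw [smul_mul_assoc, h₂]⟩

theorem arrow_mul_mem_cornerPiece (f : PreprojectiveAlgebra k V) {a b : Symmetrify V} (β : a ⟶ b)
    {s : ℕ} {x : PreprojectiveAlgebra k V} (hx : x ∈ cornerPiece f b s) :
    ofPath k β.toPath * x ∈ cornerPiece f a (s + 1) :=
  ⟨arrow_mul_mem_piece β hx.1, by rw [← mul_assoc, vertex_mul_ofPath], by rw [mul_assoc, hx.2.2]⟩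

instance (f : PreprojectiveAlgebra k V) (i : Symmetrify V) (s : ℕ) :
    FiniteDimensional k (cornerPiece f i s) :=
  have := finite_piece k (V := V) s
  Submodule.finiteDimensional_of_le (S₂ := piece k V s) fun _ hx => hx.1

/-- Left multiplication by an arrow. -/
noncomputable def cornerAct (f : PreprojectiveAlgebra k V) ⦃a b : Symmetrify V⦄ (β : a ⟶ b)
    (s : ℕ) : cornerPiece f b s →ₗ[k] cornerPiece f a (s + 1) :=
  (LinearMap.mulLeft k (ofPath k β.toPath)).restrict fun _ hx => arrow_mul_mem_cornerPiece f β hx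

theorem coe_cornerAct (f : PreprojectiveAlgebra k V) {a b : Symmetrify V} (β : a ⟶ b)
    (s : ℕ) (x : cornerPiece f b s) :
    (cornerAct f β s x : PreprojectiveAlgebra k V) = ofPath k β.toPath * x := rfl

theorem vertex_mul_mul_mem_cornerPiece {f x : PreprojectiveAlgebra k V} {s : ℕ} (hf : f * f = f)
    (hfp : f ∈ piece k V 0) (i : Symmetrify V) (hx : x ∈ piece k V s) :
    vertex k i * x * f ∈ cornerPiece f i s :=
  ⟨by simpa using mul_mem_piece (vertex_mul_mem_piece i hx) hfp,
    by rw [← mul_assoc, ← mul_assoc, vertex_mul_vertex], by rw [mul_assoc, hf]⟩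

/-- Right multiplication by `f` commutes with left multiplication by arrows, so generators and
preimages can be cut down by `f`. The case `f = e_j` serves the socle argument, `f = 1` the traces.
-/
theorem isMeshModule_cornerAct {f : PreprojectiveAlgebra k V} (hf : f * f = f)
    (hfp : f ∈ piece k V 0) : IsMeshModule (doubleSign k V) (cornerAct f) where
  sign_ne_zero _ _ β := doubleSign_ne_zero β
  surjective i s x := by
    obtain ⟨y, hy, hxy⟩ := exists_eq_sum_arrow_mul x.2.1
    refine ⟨fun b => ⟨vertex k b.1 * y ⟨i, b⟩ * f,
      vertex_mul_mul_mem_cornerPiece hf hfp b.1 (hy ⟨i, b⟩)⟩, Subtype.ext ?_⟩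
    have hxf : (x : PreprojectiveAlgebra k V)
        = ∑ b : Quiver.Star i, ofPath k b.2.toPath * y ⟨i, b⟩ * f := by
      rw [← x.2.2.2, ← x.2.2.1, hxy, Fintype.sum_sigma, Finset.mul_sum, Finset.sum_eq_single i,
        Finset.mul_sum, Finset.sum_mul]
      · refine Finset.sum_congr rfl fun b _ => ?_
        rw [← mul_assoc, vertex_mul_ofPath]
      · intro j _ hj
        rw [Finset.mul_sum]
        refine Finset.sum_eq_zero fun b _ => ?_
        rw [← mul_assoc, vertex, ofPath_mul_ofPath_of_ne _ _ hj.symm, zero_mul]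
      · simp
    rw [AddSubmonoidClass.coe_finsetSum, hxf]
    refine Finset.sum_congr rfl fun b _ => ?_
    rw [coe_cornerAct, ← mul_assoc, ← mul_assoc, ofPath_mul_vertex]
  mesh i s y := by
    refine Subtype.ext ?_
    rw [AddSubmonoidClass.coe_finsetSum, ZeroMemClass.coe_zero,
      ← zero_mul (y : PreprojectiveAlgebra k V), ← sum_sign_arrow_mul_reverse i, Finset.sum_mul]
    refine Finset.sum_congr rfl fun b _ => ?_
    rw [SetLike.val_smul, coe_cornerAct, coe_cornerAct, smul_mul_assoc, mul_assoc]
  exact_zero i x hx := by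
    have h := eq_zero_of_sum_arrow_mul_eq_zero (fun b => (x b : PreprojectiveAlgebra k V))
      (fun b => (x b).2.1) (fun b => (x b).2.2.1) (by
        have := congrArg Subtype.val hx
        rwa [AddSubmonoidClass.coe_finsetSum] at this)
    exact funext fun b => Subtype.ext (congrFun h b)
  exact_succ i s x hx := by
    obtain ⟨y, hy, h⟩ := exists_of_sum_arrow_mul_eq_zero
      (fun b => (x b : PreprojectiveAlgebra k V))
      (fun b => (x b).2.1) (fun b => (x b).2.2.1) (by
        have := congrArg Subtype.val hx
        rwa [AddSubmonoidClass.coe_finsetSum] at this)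
    refine ⟨⟨vertex k i * y * f, vertex_mul_mul_mem_cornerPiece hf hfp i hy⟩,
      fun b => Subtype.ext ?_⟩
    rw [SetLike.val_smul, coe_cornerAct, ← (x b).2.2.2]
    rw [h b, smul_mul_assoc, ← mul_assoc, ← mul_assoc, ofPath_mul_vertex]

theorem cornerPiece_vertex_zero (j i : Symmetrify V) {x : PreprojectiveAlgebra k V}
    (hx : x ∈ cornerPiece (vertex k j) i 0) : ∃ r : k, x = r • (vertex k i * vertex k j) := by
  obtain ⟨r, hr⟩ := exists_vertex_mul_eq hx.1
  exact ⟨r i, by rw [← smul_mul_assoc, ← hr, hx.2.1, hx.2.2]⟩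

theorem vertex_mem_cornerPiece (j : Symmetrify V) :
    vertex k j ∈ cornerPiece (vertex k j : PreprojectiveAlgebra k V) j 0 :=
  ⟨vertex_mem_piece j, vertex_mul_vertex j, vertex_mul_vertex j⟩

/-- Nonzero elements of the preprojective algebra of a quiver with a positive additive function are
not killed by all arrows. -/
theorem hasNoSocle_cornerAct_one (δ : Symmetrify V → ℕ) (hδ : ∀ i, 0 < δ i)
    (hadd : ∀ i : Symmetrify V, ∑ b : Quiver.Star i, δ b.1 = 2 * δ i) (s : ℕ) :
    HasNoSocle (cornerAct (1 : PreprojectiveAlgebra k V)) s := by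
  have key : ∀ j : Symmetrify V, HasNoSocle (cornerAct (vertex k j)) s := by
    intro j
    have hmesh := isMeshModule_cornerAct (vertex_mul_vertex (k := k) j) (vertex_mem_piece j)
    have hj : (⟨vertex k j, vertex_mem_cornerPiece j⟩ : cornerPiece (vertex k j) j 0) ≠ 0 :=
      fun h => vertex_ne_zero j (congrArg Subtype.val h)
    refine IsMeshModule.hasNoSocle_of_nontrivial hmesh (fun θ => ?_) (fun s => hmesh.nontrivial_of_additive
      δ hδ hadd ⟨j, ⟨_, _, hj⟩⟩ (s + 1)) s
    obtain ⟨l, hl⟩ := cornerPiece_vertex_zero j j (θ j ⟨vertex k j, vertex_mem_cornerPiece j⟩).2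
    rw [vertex_mul_vertex] at hl
    refine ⟨l, fun i y => ?_⟩
    obtain ⟨r, hr⟩ := cornerPiece_vertex_zero j i y.2
    rcases eq_or_ne i j with rfl | hij
    · rw [vertex_mul_vertex] at hr
      have hy : y = r • ⟨vertex k i, vertex_mem_cornerPiece i⟩ := Subtype.ext hr
      refine Subtype.ext ?_
      rw [hy, map_smul, SetLike.val_smul, hl, SetLike.val_smul, SetLike.val_smul, smul_comm]
    · rw [vertex_mul_vertex_of_ne hij, smul_zero] at hr
      have hy : y = 0 := Subtype.ext hr
      rw [hy, map_zero, smul_zero]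
  intro i y hy
  refine Subtype.ext ?_
  -- Degree `0` endomorphisms are scalars for a single `A e_j`, which is why the socle is treated
  -- there and `y` is split as `∑ y e_j`.
  have h₁ : (y : PreprojectiveAlgebra k V) = ∑ j, (y : PreprojectiveAlgebra k V) * vertex k j := by
    rw [← Finset.mul_sum, sum_vertex, mul_one]
  rw [ZeroMemClass.coe_zero, h₁]
  refine Finset.sum_eq_zero fun j _ => ?_
  have hmem : (y : PreprojectiveAlgebra k V) * vertex k j ∈ cornerPiece (vertex k j) i s := by
    have := vertex_mul_mul_mem_cornerPiece (vertex_mul_vertex (k := k) j) (vertex_mem_piece j) i y.2.1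
    rwa [y.2.2.1] at this
  refine congrArg Subtype.val (key j i ⟨_, hmem⟩ fun b => Subtype.ext ?_)
  rw [coe_cornerAct, ← mul_assoc]
  have := congrArg Subtype.val (hy b)
  rw [coe_cornerAct, ZeroMemClass.coe_zero] at this
  rw [this, zero_mul]
  rfl

end PreprojectiveAlgebra

/-! ### Traces of endomorphisms scaling the arrows -/

theorem LinearMap.trace_restrict_congr {k M : Type*} [Field k] [AddCommGroup M] [Module k M]
    {p q : Submodule k M} (h : p = q) (f : M →ₗ[k] M) (hp : ∀ x ∈ p, f x ∈ p)
    (hq : ∀ x ∈ q, f x ∈ q) :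
    LinearMap.trace k p (f.restrict hp) = LinearMap.trace k q (f.restrict hq) := by
  subst h
  rfl

-- Coefficientwise: the three hypotheses treat degree `0`, degree `1` and all degrees from `2` on.
open PowerSeries in
theorem PowerSeries.mul_sub_sum_eq_one {k ι : Type*} [Field k] [Fintype ι] {l : k}
    {T : PowerSeries k} {w : ι → k} {S : ι → PowerSeries k} (h₀ : coeff 0 T = 1)
    (h₁ : coeff 1 T = ∑ b, w b * coeff 0 (S b))
    (h₂ : ∀ s, coeff (s + 2) T + l * coeff s T = ∑ b, w b * coeff (s + 1) (S b)) :
    (1 + C l * X ^ 2) * T - ∑ b, C (w b) * X * S b = 1 := by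
  ext s
  rw [map_sub, map_sum, add_mul, one_mul, map_add, mul_assoc]
  simp only [mul_assoc, coeff_C_mul]
  match s with
  | 0 =>
    rw [h₀]
    simp [coeff_zero_X_mul, pow_two, mul_assoc]
  | 1 =>
    have hX : coeff 1 (X ^ 2 * T) = 0 := by
      rw [pow_two, mul_assoc, coeff_succ_X_mul, coeff_zero_X_mul]
    rw [hX, h₁]
    simp only [coeff_succ_X_mul, mul_zero, add_zero, sub_self, coeff_one]
    simp
  | s + 2 =>
    rw [coeff_X_pow_mul]
    simp only [coeff_succ_X_mul, coeff_one]
    rw [h₂]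
    simp

namespace PreprojectiveAlgebra

variable {k V : Type*} [Field k] [Quiver V] [Fintype V] [∀ a b : V, Fintype (a ⟶ b)]

/-- A linear endomorphism which fixes the idempotents and is compatible with left multiplication by
arrows, up to the weights `w`. -/
structure ScalesLeft (G : PreprojectiveAlgebra k V →ₗ[k] PreprojectiveAlgebra k V)
    (w : ∀ ⦃a b : Symmetrify V⦄, (a ⟶ b) → k) : Prop where
  map_vertex : ∀ i : Symmetrify V, G (vertex k i) = vertex k i
  map_arrow_mul : ∀ ⦃a b : Symmetrify V⦄ (β : a ⟶ b) x,
    G (ofPath k β.toPath * x) = w β • (ofPath k β.toPath * G x)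

namespace ScalesLeft

variable {G : PreprojectiveAlgebra k V →ₗ[k] PreprojectiveAlgebra k V}
  {w : ∀ ⦃a b : Symmetrify V⦄, (a ⟶ b) → k}

/-- Stripping initial arrows one at a time collects their weights and ends at a fixed idempotent.
Multiplicativity of `G` is not needed. -/
theorem exists_map_ofPath (h : ScalesLeft G w) {a b : Symmetrify V} (p : Path a b) :
    ∃ r : k, G (ofPath k p) = r • ofPath k p := by
  obtain ⟨n, hn⟩ : ∃ n, p.length = n := ⟨_, rfl⟩
  induction n generalizing a with
  | zero =>
    obtain rfl := Path.eq_of_length_zero p hn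
    obtain rfl := Path.eq_nil_of_length_zero p hn
    exact ⟨1, by rw [one_smul]; exact h.map_vertex a⟩
  | succ n ih =>
    obtain ⟨c, e, q, rfl, hq⟩ := (Path.length_ne_zero_iff_eq_comp p).1 (by omega)
    obtain ⟨r, hr⟩ := ih q (by omega)
    refine ⟨w e * r, ?_⟩
    rw [← ofPath_mul_ofPath, h.map_arrow_mul, hr, mul_smul_comm, smul_smul]

theorem map_mem_piece (h : ScalesLeft G w) {s : ℕ} {x : PreprojectiveAlgebra k V}
    (hx : x ∈ piece k V s) : G x ∈ piece k V s := by
  refine piece_induction (P := fun x => G x ∈ piece k V s) (by rw [map_zero]; exact zero_mem _)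
    (fun x y hx hy => by rw [map_add]; exact add_mem hx hy)
    (fun r x hx => by rw [map_smul]; exact Submodule.smul_mem _ _ hx) (fun a b p hp => ?_) hx
  obtain ⟨r, hr⟩ := h.exists_map_ofPath p
  rw [hr, ← hp]
  exact Submodule.smul_mem _ _ (ofPath_mem_piece p)

theorem map_vertex_mul (h : ScalesLeft G w) (i : Symmetrify V) {s : ℕ}
    {x : PreprojectiveAlgebra k V} (hx : x ∈ piece k V s) :
    G (vertex k i * x) = vertex k i * G x := by
  refine piece_induction (P := fun x => G (vertex k i * x) = vertex k i * G x)
    (by simp only [mul_zero, map_zero])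
    (fun x y hx hy => by simp only [mul_add, map_add, hx, hy])
    (fun r x hx => by simp only [mul_smul_comm, map_smul, hx]) (fun a b p hp => ?_) hx
  obtain ⟨r, hr⟩ := h.exists_map_ofPath p
  rw [hr, mul_smul_comm]
  by_cases hi : i = a
  · subst hi
    rw [vertex_mul_ofPath, hr]
  · rw [vertex, ofPath_mul_ofPath_of_ne _ _ hi, map_zero, smul_zero]

theorem map_mem_cornerPiece (h : ScalesLeft G w) (i : Symmetrify V) (s : ℕ)
    (x : PreprojectiveAlgebra k V) (hx : x ∈ cornerPiece 1 i s) : G x ∈ cornerPiece 1 i s :=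
  ⟨h.map_mem_piece hx.1, by rw [← h.map_vertex_mul i hx.1, hx.2.1], mul_one _⟩

/-- The weights of an arrow and of its opposite multiply to a constant at every vertex. -/
theorem exists_mul_reverse_eq (h : ScalesLeft G w) (i : Symmetrify V) :
    ∃ l : k, ∀ b : Quiver.Star i, w b.2 * w (reverse b.2) = l := by
  have hG : ∀ {a b : Symmetrify V} (β : a ⟶ b),
      G (ofPath k β.toPath) = w β • ofPath k β.toPath := by
    intro a b β
    have := h.map_arrow_mul β (vertex k b)
    rwa [h.map_vertex, ofPath_mul_vertex] at this
  have h₁ := congrArg G (sum_sign_arrow_mul_reverse (k := k) i)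
  rw [map_zero, map_sum] at h₁
  have harr : ∀ {a b : Symmetrify V} (β : a ⟶ b), ofPath k β.toPath ∈ piece k V 1 :=
    fun β => ofPath_mem_piece β.toPath
  -- The image under `G` of the mesh relation at `i` is a relation with coefficients `w b * w b*`.
  -- By exactness it is the mesh relation times some `y` of degree `0`, and `y` acts at `i` as a
  -- scalar, the desired constant.
  obtain ⟨y, hy, hxy⟩ := exists_of_sum_arrow_mul_eq_zero (i := i) (s := 0)
    (fun b => (doubleSign k V b.2 * (w b.2 * w (reverse b.2))) • ofPath k (reverse b.2).toPath)
    (fun b => Submodule.smul_mem _ _ (harr _))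
    (fun b => by rw [mul_smul_comm, vertex_mul_ofPath]) (by
      rw [← h₁]
      refine Finset.sum_congr rfl fun b _ => ?_
      rw [map_smul, h.map_arrow_mul, hG, mul_smul_comm, mul_smul_comm, smul_smul, smul_smul,
        mul_assoc])
  obtain ⟨r, hr⟩ := exists_vertex_mul_eq hy
  refine ⟨r i, fun b => ?_⟩
  have h₂ := hxy b
  rw [mul_smul] at h₂
  have h₃ := smul_right_injective _ (doubleSign_ne_zero b.2) h₂
  rw [← ofPath_mul_vertex (k := k) (reverse b.2).toPath, mul_assoc, hr, mul_smul_comm,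
    ofPath_mul_vertex] at h₃
  exact smul_left_injective _ (arrow_ne_zero _) h₃

theorem cornerPiece_one (i : Symmetrify V) (s : ℕ) :
    cornerPiece (1 : PreprojectiveAlgebra k V) i s = rightPiece (V := V) k i s := by
  ext x
  constructor
  · rintro ⟨h, h', -⟩
    exact ⟨x, h, h'⟩
  · rintro ⟨x, hx, rfl⟩
    refine ⟨vertex_mul_mem_piece i hx, ?_, mul_one _⟩
    exact (mul_assoc _ _ _).symm.trans (congrArg (· * x) (vertex_mul_vertex (k := k) (V := V) i))

theorem trace_cornerPiece_zero (h : ScalesLeft G w) (i : Symmetrify V) :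
    LinearMap.trace k (cornerPiece 1 i 0) (G.restrict (h.map_mem_cornerPiece i 0)) = 1 := by
  have hx : ∀ x : cornerPiece (1 : PreprojectiveAlgebra k V) i 0, ∃ r : k,
      (x : PreprojectiveAlgebra k V) = r • vertex k i := by
    intro x
    obtain ⟨r, hr⟩ := exists_vertex_mul_eq x.2.1
    exact ⟨r i, by rw [← hr, x.2.2.1]⟩
  have hid : G.restrict (h.map_mem_cornerPiece i 0) = LinearMap.id := by
    ext x
    obtain ⟨r, hr⟩ := hx x
    rw [LinearMap.coe_restrict_apply, LinearMap.id_apply, hr, map_smul, h.map_vertex]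
  have hmem : vertex k i ∈ cornerPiece (1 : PreprojectiveAlgebra k V) i 0 :=
    ⟨vertex_mem_piece i, vertex_mul_vertex i, mul_one _⟩
  rw [hid, LinearMap.trace_id, finrank_eq_one (⟨vertex k i, hmem⟩ : cornerPiece 1 i 0)
    (fun h0 => vertex_ne_zero i (congrArg Subtype.val h0)) fun x => ?_, Nat.cast_one]
  obtain ⟨r, hr⟩ := hx x
  exact ⟨r, Subtype.ext hr.symm⟩

open PowerSeries in
/-- The linear equations satisfied by the generating series of the traces on the spaces `e_i A_s`.
-/
theorem trace_series_eq (h : ScalesLeft G w) (δ : Symmetrify V → ℕ) (hδ : ∀ i, 0 < δ i)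
    (hadd : ∀ i : Symmetrify V, ∑ b : Quiver.Star i, δ b.1 = 2 * δ i) {l : k}
    (hl : ∀ i : Symmetrify V, ∀ b : Quiver.Star i, w b.2 * w (reverse b.2) = l)
    {T : Symmetrify V → PowerSeries k}
    (hG : ∀ (i : Symmetrify V) (s : ℕ), ∀ x ∈ rightPiece (V := V) k i s,
      G x ∈ rightPiece (V := V) k i s)
    (hT : ∀ i s, coeff s (T i)
      = LinearMap.trace k (rightPiece (V := V) k i s) (G.restrict (hG i s)))
    (i : Symmetrify V) :
    (1 + C l * X ^ 2) * T i - ∑ b : Quiver.Star i, C (w b.2) * X * T b.1 = 1 := by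
  have hmesh := isMeshModule_cornerAct (f := (1 : PreprojectiveAlgebra k V)) (mul_one _) (by
    rw [← sum_vertex]
    exact sum_mem fun i _ => vertex_mem_piece i)
  have hsoc := hasNoSocle_cornerAct_one (k := k) (V := V) δ hδ hadd
  let H : ∀ (i : Symmetrify V) s, cornerPiece (1 : PreprojectiveAlgebra k V) i s →ₗ[k]
      cornerPiece (1 : PreprojectiveAlgebra k V) i s :=
    fun i s => G.restrict (h.map_mem_cornerPiece i s)
  have hH : ∀ ⦃a b : Symmetrify V⦄ (β : a ⟶ b) s y,
      H a (s + 1) (cornerAct 1 β s y) = w β • cornerAct 1 β s (H b s y) :=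
    fun a b β s y => Subtype.ext (h.map_arrow_mul β y)
  have hT' : ∀ (i : Symmetrify V) s, coeff s (T i) = LinearMap.trace k _ (H i s) :=
    fun i s => (hT i s).trans (LinearMap.trace_restrict_congr (cornerPiece_one i s) G _ _).symm
  refine PowerSeries.mul_sub_sum_eq_one ?_ ?_ fun s => ?_
  · rw [hT']
    exact h.trace_cornerPiece_zero i
  · simp only [hT']
    exact hmesh.trace_one w H hH i
  · simp only [hT']
    exact hmesh.trace_succ_succ hsoc w (fun a b β => hl a ⟨b, β⟩) H hH i s

end ScalesLeft

end PreprojectiveAlgebra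

/-! ### The reversal of paths -/

namespace PathAlgebra

variable {k V : Type*} [Field k] [Quiver V]

variable (k V) in
/-- The linear map reversing paths. -/
noncomputable def reverseLinear :
    PathAlgebra k (Symmetrify V) →ₗ[k] PathAlgebra k (Symmetrify V) :=
  liftLinear fun _ _ p => ofPath k p.reverse

theorem reverseLinear_ofPath {a b : Symmetrify V} (p : Path a b) :
    reverseLinear k V (ofPath k p) = ofPath k p.reverse :=
  liftLinear_ofPath _ p

theorem reverseLinear_mul (x y : PathAlgebra k (Symmetrify V)) :
    reverseLinear k V (x * y) = reverseLinear k V y * reverseLinear k V x := by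
  refine induction_on (P := fun x => reverseLinear k V (x * y)
    = reverseLinear k V y * reverseLinear k V x) x
    (by rw [zero_mul', map_zero, mul_zero'])
    (fun x z hx hz => by rw [add_mul', map_add, map_add, mul_add', hx, hz]) fun r a b p => ?_
  refine induction_on (P := fun y => reverseLinear k V (r • ofPath k p * y)
    = reverseLinear k V y * reverseLinear k V (r • ofPath k p)) y
    (by rw [mul_zero', map_zero, zero_mul'])
    (fun x z hx hz => by rw [mul_add', map_add, map_add, add_mul', hx, hz]) fun r' c d q => ?_
  simp only [smul_mul', mul_smul', map_smul, reverseLinear_ofPath]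
  rw [smul_comm]
  congr 2
  by_cases h : b = c
  · subst h
    rw [ofPath_mul_ofPath, ofPath_mul_ofPath, reverseLinear_ofPath, Path.reverse_comp]
  · rw [ofPath_mul_ofPath_of_ne _ _ h, ofPath_mul_ofPath_of_ne _ _ (Ne.symm h), map_zero]

/-- Reversing `β β*` gives `β β*` again, so the relation is fixed by reversal. -/
theorem reverseLinear_mem_preprojectiveIdeal [Fintype V] [∀ a b : V, Fintype (a ⟶ b)]
    {x : PathAlgebra k (Symmetrify V)} (hx : x ∈ preprojectiveIdeal k V) :
    reverseLinear k V x ∈ preprojectiveIdeal k V := by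
  unfold preprojectiveIdeal at hx
  induction hx using TwoSidedIdeal.span_induction with
  | mem x h =>
    have h₁ : reverseLinear k V (preprojectiveRelation k V) = preprojectiveRelation k V := by
      rw [preprojectiveRelation_eq_sum, map_sum]
      refine Finset.sum_congr rfl fun b _ => ?_
      rw [map_smul, reverseLinear_mul, reverseLinear_ofPath, reverseLinear_ofPath,
        Path.reverse_toPath, Path.reverse_toPath, reverse_reverse]
    rw [Set.mem_singleton_iff.1 h, h₁]
    exact preprojectiveRelation_mem
  | zero => rw [map_zero]; exact zero_mem _
  | add x y _ _ hx hy => rw [map_add]; exact add_mem hx hy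
  | neg x _ hx => rw [map_neg]; exact neg_mem hx
  | left_absorb a x _ hx =>
    rw [reverseLinear_mul]
    exact TwoSidedIdeal.mul_mem_right _ _ _ hx
  | right_absorb a x _ hx =>
    rw [reverseLinear_mul]
    exact TwoSidedIdeal.mul_mem_left _ _ _ hx

end PathAlgebra

namespace PreprojectiveAlgebra

variable {k V : Type*} [Field k] [Quiver V] [Fintype V] [∀ a b : V, Fintype (a ⟶ b)]

/-- Reversing paths induces an involutive anti-automorphism of the preprojective algebra. -/
theorem exists_reversal : ∃ τ : PreprojectiveAlgebra k V →ₗ[k] PreprojectiveAlgebra k V,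
    (∀ ⦃a b : Symmetrify V⦄ (p : Path a b), τ (ofPath k p) = ofPath k p.reverse) ∧
    (∀ x y, τ (x * y) = τ y * τ x) ∧ ∀ x, τ (τ x) = x := by
  let q := Ideal.Quotient.mkₐ k (preprojectiveIdeal k V).asIdeal
  have hq : Function.Surjective q := Ideal.Quotient.mkₐ_surjective _ _
  -- Any linear section of the quotient map will do: stability of the ideal under reversal makes the
  -- induced map independent of it.
  obtain ⟨σ, hσ⟩ := q.toLinearMap.exists_rightInverse_of_surjective (LinearMap.range_eq_top.2 hq)
  let τ := q.toLinearMap ∘ₗ PathAlgebra.reverseLinear k V ∘ₗ σ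
  have hτ : ∀ x, τ (q x) = q (PathAlgebra.reverseLinear k V x) := by
    intro x
    have h₁ : q (σ (q x)) = q x := LinearMap.congr_fun hσ (q x)
    change q (PathAlgebra.reverseLinear k V (σ (q x))) = q (PathAlgebra.reverseLinear k V x)
    rw [← sub_eq_zero, ← map_sub, ← map_sub]
    refine mkₐ_eq_zero_iff.2 (PathAlgebra.reverseLinear_mem_preprojectiveIdeal
      (mkₐ_eq_zero_iff.1 ?_))
    rw [map_sub]
    exact sub_eq_zero.2 h₁
  refine ⟨τ, fun a b p => ?_, fun x y => ?_, fun x => ?_⟩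
  · exact (hτ _).trans (congrArg q (PathAlgebra.reverseLinear_ofPath p))
  · obtain ⟨x, rfl⟩ := hq x
    obtain ⟨y, rfl⟩ := hq y
    rw [← map_mul, hτ, hτ, hτ, PathAlgebra.reverseLinear_mul, map_mul]
  · obtain ⟨x, rfl⟩ := hq x
    rw [hτ, hτ]
    have h₂ : PathAlgebra.reverseLinear k V ∘ₗ PathAlgebra.reverseLinear k V = LinearMap.id :=
      PathAlgebra.linearMap_ext fun a b p => by
        simp [PathAlgebra.reverseLinear_ofPath, Path.reverse_reverse]
    exact congrArg q (LinearMap.congr_fun h₂ x)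

end PreprojectiveAlgebra

/-! ### The vector traces of a graded automorphism -/

theorem sum_star_symmetrify {V M : Type*} [Quiver V] [Fintype V] [∀ a b : V, Fintype (a ⟶ b)]
    [AddCommMonoid M] (i : V) (F : ∀ ⦃a b : Symmetrify V⦄, (a ⟶ b) → M) :
    ∑ b : Quiver.Star (show Symmetrify V from i), F b.2
      = ∑ j : V, (∑ α : i ⟶ j, F (@Hom.toPos V _ i j α) + ∑ α : j ⟶ i, F (@Hom.toNeg V _ j i α)) := by
  rw [Fintype.sum_sigma]
  exact Finset.sum_congr rfl fun (j : V) _ =>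
    Fintype.sum_sum_type (α₁ := i ⟶ j) (α₂ := j ⟶ i) fun β => F (a := i) (b := j) β

section MeshMatrix

open PowerSeries

variable {k V : Type*} [Field k] [Quiver V] [DecidableEq V] [∀ a b : V, Fintype (a ⟶ b)]

/-- The matrix `(1 + l t²) - C t`, where `C` is the weighted adjacency matrix of the double. -/
noncomputable def meshMatrix (c t : ∀ ⦃a b : V⦄, (a ⟶ b) → k) (l : k) : Matrix V V (PowerSeries k) :=
  fun i j => (if i = j then 1 + C l * X ^ 2 else 0)
    - (∑ α : i ⟶ j, C (c α) * X + ∑ α : j ⟶ i, C (t α) * X)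

theorem meshMatrix_transpose (c t : ∀ ⦃a b : V⦄, (a ⟶ b) → k) (l : k) :
    (meshMatrix c t l).transpose = meshMatrix t c l := by
  ext i j : 2
  simp only [Matrix.transpose_apply, meshMatrix]
  rw [add_comm (∑ α : i ⟶ j, _)]
  simp only [eq_comm]

variable [Fintype V]

/-- Modulo `t` the matrix is the identity, so its determinant has constant term `1`. -/
theorem isUnit_det_meshMatrix (c t : ∀ ⦃a b : V⦄, (a ⟶ b) → k) (l : k) :
    IsUnit (meshMatrix c t l).det := by
  rw [PowerSeries.isUnit_iff_constantCoeff, RingHom.map_det]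
  have h : (constantCoeff (R := k)).mapMatrix (meshMatrix c t l) = 1 := by
    ext i j
    rw [RingHom.mapMatrix_apply, Matrix.map_apply, meshMatrix, Matrix.one_apply]
    split_ifs <;> simp
  rw [h, Matrix.det_one]
  exact isUnit_one

theorem meshMatrix_mulVec (c t : ∀ ⦃a b : V⦄, (a ⟶ b) → k) (l : k) (T : V → PowerSeries k)
    (i : V) : (meshMatrix c t l).mulVec T i = (1 + C l * X ^ 2) * T i -
      ∑ b : Quiver.Star (show Symmetrify V from i), C (doubleElim c t b.2) * X * T b.1 := by
  have h : (meshMatrix c t l).mulVec T i = (1 + C l * X ^ 2) * T i -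
      ∑ j, (∑ α : i ⟶ j, C (c α) * X * T j + ∑ α : j ⟶ i, C (t α) * X * T j) := by
    simp only [Matrix.mulVec, dotProduct, meshMatrix, sub_mul, Finset.sum_sub_distrib, ite_mul,
      zero_mul, Finset.sum_ite_eq, Finset.mem_univ, if_true, add_mul, Finset.sum_mul]
  exact h.trans (congrArg _ (sum_star_symmetrify i
    (fun _ b β => C (doubleElim c t β) * X * T b)).symm)

end MeshMatrix

namespace PreprojectiveAlgebra

variable {k V : Type*} [Field k] [Quiver V] [Fintype V] [∀ a b : V, Fintype (a ⟶ b)]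

theorem scalesLeft_of_scalesArrows {g : PreprojectiveAlgebra k V ≃ₐ[k] PreprojectiveAlgebra k V}
    (hg : IsGradedAut g) {c t : ∀ ⦃a b : V⦄, (a ⟶ b) → k} (h : ScalesArrows g c t) :
    ScalesLeft g.toLinearMap (doubleElim c t) where
  map_vertex i := hg.map_idem i
  map_arrow_mul a b β x := by
    have hβ : g (ofPath k β.toPath) = doubleElim c t β • ofPath k β.toPath := by
      rcases β with α | α
      · exact (h α).1
      · exact (h α).2
    rw [AlgEquiv.toLinearMap_apply, AlgEquiv.toLinearMap_apply, map_mul, hβ, smul_mul_assoc]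

theorem map_mem_piece_of_reversal {τ : PreprojectiveAlgebra k V →ₗ[k] PreprojectiveAlgebra k V}
    (hτ : ∀ ⦃a b : Symmetrify V⦄ (p : Path a b), τ (ofPath k p) = ofPath k p.reverse) {s : ℕ}
    {x : PreprojectiveAlgebra k V} (hx : x ∈ piece k V s) : τ x ∈ piece k V s := by
  refine piece_induction (P := fun x => τ x ∈ piece k V s) (by rw [map_zero]; exact zero_mem _)
    (fun x y hx hy => by rw [map_add]; exact add_mem hx hy)
    (fun r x hx => by rw [map_smul]; exact Submodule.smul_mem _ _ hx) (fun a b p hp => ?_) hx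
  have hlen : ∀ {a b : Symmetrify V} (p : Path a b), p.reverse.length = p.length := by
    intro a b p
    induction p with
    | nil => rfl
    | cons p e ih => rw [Path.reverse, Path.length_comp, ih, Path.length_toPath, Path.length_cons,
        add_comm]
  rw [hτ, ← hp, ← hlen p]
  exact ofPath_mem_piece _

/-- The product of the weights of an arrow and of its opposite is the same for arrows with a common
vertex. -/
theorem mul_eq_mul_of_scalesArrows
    {g : PreprojectiveAlgebra k V ≃ₐ[k] PreprojectiveAlgebra k V} (hg : IsGradedAut g)
    {c t : ∀ ⦃a b : V⦄, (a ⟶ b) → k} (h : ScalesArrows g c t) :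
    ∃ l : V → k, ∀ ⦃a b : V⦄ (α : a ⟶ b), c α * t α = l a ∧ c α * t α = l b := by
  choose l hl using (scalesLeft_of_scalesArrows hg h).exists_mul_reverse_eq
  exact ⟨l, fun a b α => ⟨hl a ⟨b, @Hom.toPos V _ a b α⟩,
    (mul_comm _ _).trans (hl b ⟨a, @Hom.toNeg V _ a b α⟩)⟩⟩

variable [DecidableEq V]

/-- The vector trace on the spaces `e_j A_s` of an automorphism scaling the arrows. -/
theorem meshMatrix_mulVec_lowerVectorTrace {δ : V → ℕ} (hδ : ∀ i, 0 < δ i)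
    (hadd : ∀ i : V, ∑ j : V, (∑ _ : i ⟶ j, δ j + ∑ _ : j ⟶ i, δ j) = 2 * δ i)
    {g : PreprojectiveAlgebra k V ≃ₐ[k] PreprojectiveAlgebra k V} (hg : IsGradedAut g)
    {c t : ∀ ⦃a b : V⦄, (a ⟶ b) → k} (h : ScalesArrows g c t) {l : k}
    (hl : ∀ ⦃a b : V⦄ (α : a ⟶ b), c α * t α = l) :
    (meshMatrix c t l).mulVec (lowerVectorTrace g hg) = fun _ => 1 := by
  funext i
  rw [meshMatrix_mulVec]
  refine (scalesLeft_of_scalesArrows hg h).trace_series_eq (T := (lowerVectorTrace g hg : V → PowerSeries k)) δ hδ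
    (fun i => (sum_star_symmetrify (V := V) i (fun _ b _ => δ b)).trans (hadd i))
    (fun i b => ?_) (fun i s => hg.mapsTo_rightPiece i s) (fun i s => PowerSeries.coeff_mk _ _) i
  obtain ⟨j, α | α⟩ := b
  · exact hl α
  · exact (mul_comm _ _).trans (hl α)

/-- The vector trace on the spaces `A_s e_j` of an automorphism scaling the arrows. -/
theorem meshMatrix_mulVec_upperVectorTrace {δ : V → ℕ} (hδ : ∀ i, 0 < δ i)
    (hadd : ∀ i : V, ∑ j : V, (∑ _ : i ⟶ j, δ j + ∑ _ : j ⟶ i, δ j) = 2 * δ i)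
    {g : PreprojectiveAlgebra k V ≃ₐ[k] PreprojectiveAlgebra k V} (hg : IsGradedAut g)
    {c t : ∀ ⦃a b : V⦄, (a ⟶ b) → k} (h : ScalesArrows g c t) {l : k}
    (hl : ∀ ⦃a b : V⦄ (α : a ⟶ b), c α * t α = l) :
    (meshMatrix t c l).mulVec (upperVectorTrace g hg) = fun _ => 1 := by
  obtain ⟨τ, hτ, hτmul, hττ⟩ := exists_reversal (k := k) (V := V)
  have hτv : ∀ i : Symmetrify V, τ (vertex k i) = vertex k i := fun i => hτ _
  -- Conjugation by `τ` turns `g` on `A_s e_j` into a map on `e_j A_s` in which the weights of `α`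
  -- and `α*` are exchanged; traces are unchanged by conjugation.
  have hG : ScalesLeft (τ ∘ₗ g.toLinearMap ∘ₗ τ) (doubleElim t c) := by
    refine ⟨fun i => ?_, fun a b β x => ?_⟩
    · rw [LinearMap.comp_apply, LinearMap.comp_apply, hτv, AlgEquiv.toLinearMap_apply]
      exact (congrArg τ (hg.map_idem i)).trans (hτv i)
    · have hβ : g (ofPath k (reverse β).toPath)
          = doubleElim t c β • ofPath k (reverse β).toPath := by
        rcases β with α | α
        · exact (h α).2
        · exact (h α).1
      simp only [LinearMap.comp_apply, AlgEquiv.toLinearMap_apply]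
      rw [hτmul, hτ, Path.reverse_toPath, map_mul, hβ, mul_smul_comm, map_smul, hτmul, hτ,
        Path.reverse_toPath, reverse_reverse]
  have hleft : ∀ (i : Symmetrify V) s, ∀ x ∈ leftPiece (V := V) k i s,
      τ x ∈ rightPiece (V := V) k i s := by
    rintro i s _ ⟨x, hx, rfl⟩
    exact ⟨τ x, map_mem_piece_of_reversal hτ hx,
      ((hτmul x (vertex k i)).trans (congrArg (· * τ x) (hτv i))).symm⟩
  have hright : ∀ (i : Symmetrify V) s, ∀ x ∈ rightPiece (V := V) k i s,
      τ x ∈ leftPiece (V := V) k i s := by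
    rintro i s _ ⟨x, hx, rfl⟩
    exact ⟨τ x, map_mem_piece_of_reversal hτ hx,
      ((hτmul (vertex k i) x).trans (congrArg (τ x * ·) (hτv i))).symm⟩
  have hGmem : ∀ (i : Symmetrify V) s, ∀ x ∈ rightPiece (V := V) k i s,
      (τ ∘ₗ g.toLinearMap ∘ₗ τ) x ∈ rightPiece (V := V) k i s :=
    fun i s x hx => hleft i s _ (hg.mapsTo_leftPiece i s _ (hright i s x hx))
  funext i
  rw [meshMatrix_mulVec]
  refine hG.trace_series_eq (T := (upperVectorTrace g hg : V → PowerSeries k)) δ hδ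
    (fun i => (sum_star_symmetrify (V := V) i (fun _ b _ => δ b)).trans (hadd i))
    (fun i b => ?_) hGmem (fun i s => (PowerSeries.coeff_mk _ _).trans ?_) i
  · obtain ⟨j, α | α⟩ := b
    · exact (mul_comm _ _).trans (hl α)
    · exact hl α
  · let e : leftPiece (V := V) k i s ≃ₗ[k] rightPiece (V := V) k i s :=
      LinearEquiv.ofLinearMap (τ.restrict (hleft i s)) (τ.restrict (hright i s))
        (LinearMap.ext fun x => Subtype.ext (hττ x)) (LinearMap.ext fun x => Subtype.ext (hττ x))
    rw [← LinearMap.trace_conj' _ e]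
    rfl

theorem vectorTrace_eq {δ : V → ℕ} (hδ : ∀ i, 0 < δ i)
    (hadd : ∀ i : V, ∑ j : V, (∑ _ : i ⟶ j, δ j + ∑ _ : j ⟶ i, δ j) = 2 * δ i)
    {g : PreprojectiveAlgebra k V ≃ₐ[k] PreprojectiveAlgebra k V} (hg : IsGradedAut g)
    {c t : ∀ ⦃a b : V⦄, (a ⟶ b) → k} (h : ScalesArrows g c t) {l : k}
    (hl : ∀ ⦃a b : V⦄ (α : a ⟶ b), c α * t α = l) {M : Matrix V V (PowerSeries k)}
    (hM : M = meshMatrix c t l) :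
    IsUnit M.det ∧ lowerVectorTrace g hg = M⁻¹.mulVec (fun _ => 1) ∧
      upperVectorTrace g hg = M.transpose⁻¹.mulVec (fun _ => 1) := by
  subst hM
  refine ⟨isUnit_det_meshMatrix c t l, ?_, ?_⟩
  · rw [← meshMatrix_mulVec_lowerVectorTrace hδ hadd hg h hl, Matrix.mulVec_mulVec,
      Matrix.nonsing_inv_mul _ (isUnit_det_meshMatrix c t l), Matrix.one_mulVec]
  · rw [meshMatrix_transpose, ← meshMatrix_mulVec_upperVectorTrace hδ hadd hg h hl,
      Matrix.mulVec_mulVec, Matrix.nonsing_inv_mul _ (isUnit_det_meshMatrix t c l),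
      Matrix.one_mulVec]

end PreprojectiveAlgebra

/-! ### The three extended Dynkin quivers -/

/-- A sum over a type with at most one element, listed by `L`. -/
theorem Fintype.sum_eq_list_sum_of_subsingleton {ι M : Type*} [Fintype ι] [Subsingleton ι]
    [AddCommMonoid M] (L : List ι) (hL : ∀ a : ι, L = [a]) (F : ι → M) :
    ∑ a, F a = (L.map F).sum := by
  rcases isEmpty_or_nonempty ι with h | ⟨⟨a⟩⟩
  · cases L with
    | nil => simp
    | cons a _ => exact isEmptyElim a
  · rw [hL a, Fintype.sum_subsingleton F a]
    simp

/-- The list of arrows between two vertices of `Ẽ₆`. -/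
def E6Arrow.list : ∀ i j : Fin 7, List (E6Arrow i j)
  | 0, 1 => [.α₁]
  | 1, 2 => [.α₂]
  | 2, 3 => [.α₃]
  | 3, 4 => [.α₄]
  | 2, 5 => [.α₆]
  | 5, 6 => [.α₇]
  | _, _ => []

theorem E6Arrow.list_eq {i j : Fin 7} (α : E6Arrow i j) : E6Arrow.list i j = [α] := by
  cases α <;> rfl

/-- The `Fintype` structure on arrows is noncomputable; explicit lists make the matrix entries and
the additivity of `δ` checkable by evaluation. -/
theorem E6Tilde.sum_hom {M : Type*} [AddCommMonoid M] (i j : E6Tilde) (F : (i ⟶ j) → M) :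
    ∑ α, F α = ((E6Arrow.list i j).map F).sum :=
  Fintype.sum_eq_list_sum_of_subsingleton (ι := i ⟶ j) _ (fun α => E6Arrow.list_eq α) F

open PowerSeries in
theorem E6Tilde.meshMatrix_apply {k : Type*} [Field k]
    (c t : ∀ ⦃a b : E6Tilde⦄, (a ⟶ b) → k) (l : k) (i j : Fin 7) :
    meshMatrix c t l i j = (if i = j then 1 + C l * X ^ 2 else 0)
      - (((E6Arrow.list i j).map fun α => C (c α) * X).sum
        + ((E6Arrow.list j i).map fun α => C (t α) * X).sum) :=
  congrArg₂ _ rfl (congrArg₂ _ (E6Tilde.sum_hom i j _) (E6Tilde.sum_hom j i _))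

theorem E6Matrix_eq_meshMatrix {k : Type*} [Field k] (c t : ∀ ⦃a b : E6Tilde⦄, (a ⟶ b) → k) :
    E6Matrix c t = meshMatrix c t (c E6Arrow.α₁ * t E6Arrow.α₁) := by
  funext (i : Fin 7) (j : Fin 7)
  refine Eq.trans ?_ (E6Tilde.meshMatrix_apply c t _ i j).symm
  fin_cases i <;> fin_cases j <;> simp [E6Arrow.list, E6Matrix]

/-- The additive function of `Ẽ₆`. -/
def E6Tilde.delta : E6Tilde → ℕ := fun i => (![1, 2, 3, 2, 1, 2, 1] : Fin 7 → ℕ) i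

theorem E6Tilde.delta_pos : ∀ i, 0 < E6Tilde.delta i := by
  decide

theorem E6Tilde.delta_additive (i : E6Tilde) :
    ∑ j : E6Tilde, (∑ _ : i ⟶ j, E6Tilde.delta j + ∑ _ : j ⟶ i, E6Tilde.delta j)
      = 2 * E6Tilde.delta i := by
  simp only [E6Tilde.sum_hom]
  revert i
  decide

/-- Arrows with a common vertex have equal products, so the value at `α₁` spreads along the tree,
entering the branch `α₆`, `α₇` from `α₂`. -/
theorem E6Tilde.mul_eq_of_scalesArrows {k : Type*} [Field k]
    {g : PreprojectiveAlgebra k E6Tilde ≃ₐ[k] PreprojectiveAlgebra k E6Tilde}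
    (hg : PreprojectiveAlgebra.IsGradedAut g) {c t : ∀ ⦃a b : E6Tilde⦄, (a ⟶ b) → k}
    (h : PreprojectiveAlgebra.ScalesArrows g c t) ⦃a b : E6Tilde⦄ (α : a ⟶ b) :
    c α * t α = c E6Arrow.α₁ * t E6Arrow.α₁ := by
  obtain ⟨l, hl⟩ := PreprojectiveAlgebra.mul_eq_mul_of_scalesArrows hg h
  have h₂ : c E6Arrow.α₂ * t E6Arrow.α₂ = c E6Arrow.α₁ * t E6Arrow.α₁ :=
    (hl E6Arrow.α₂).1.trans (hl E6Arrow.α₁).2.symm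
  have h₃ : c E6Arrow.α₃ * t E6Arrow.α₃ = c E6Arrow.α₁ * t E6Arrow.α₁ :=
    ((hl E6Arrow.α₃).1.trans (hl E6Arrow.α₂).2.symm).trans h₂
  have h₄ : c E6Arrow.α₄ * t E6Arrow.α₄ = c E6Arrow.α₁ * t E6Arrow.α₁ :=
    ((hl E6Arrow.α₄).1.trans (hl E6Arrow.α₃).2.symm).trans h₃
  have h₆ : c E6Arrow.α₆ * t E6Arrow.α₆ = c E6Arrow.α₁ * t E6Arrow.α₁ :=
    ((hl E6Arrow.α₆).1.trans (hl E6Arrow.α₂).2.symm).trans h₂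
  have h₇ : c E6Arrow.α₇ * t E6Arrow.α₇ = c E6Arrow.α₁ * t E6Arrow.α₁ :=
    ((hl E6Arrow.α₇).1.trans (hl E6Arrow.α₆).2.symm).trans h₆
  have key : ∀ {i j : Fin 7} (α : E6Arrow i j),
      @c i j α * @t i j α = c E6Arrow.α₁ * t E6Arrow.α₁ := by
    intro i j α
    cases α
    · rfl
    · exact h₂
    · exact h₃
    · exact h₄
    · exact h₆
    · exact h₇
  exact key α

/-- The list of arrows between two vertices of `Ẽ₇`. -/
def E7Arrow.list : ∀ i j : Fin 8, List (E7Arrow i j)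
  | 0, 1 => [.α₁]
  | 1, 2 => [.α₂]
  | 2, 3 => [.α₃]
  | 3, 4 => [.α₄]
  | 4, 5 => [.α₅]
  | 5, 6 => [.α₆]
  | 3, 7 => [.α₈]
  | _, _ => []

theorem E7Arrow.list_eq {i j : Fin 8} (α : E7Arrow i j) : E7Arrow.list i j = [α] := by
  cases α <;> rfl

theorem E7Tilde.sum_hom {M : Type*} [AddCommMonoid M] (i j : E7Tilde) (F : (i ⟶ j) → M) :
    ∑ α, F α = ((E7Arrow.list i j).map F).sum :=
  Fintype.sum_eq_list_sum_of_subsingleton (ι := i ⟶ j) _ (fun α => E7Arrow.list_eq α) F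

open PowerSeries in
theorem E7Tilde.meshMatrix_apply {k : Type*} [Field k]
    (c t : ∀ ⦃a b : E7Tilde⦄, (a ⟶ b) → k) (l : k) (i j : Fin 8) :
    meshMatrix c t l i j = (if i = j then 1 + C l * X ^ 2 else 0)
      - (((E7Arrow.list i j).map fun α => C (c α) * X).sum
        + ((E7Arrow.list j i).map fun α => C (t α) * X).sum) :=
  congrArg₂ _ rfl (congrArg₂ _ (E7Tilde.sum_hom i j _) (E7Tilde.sum_hom j i _))

theorem E7Matrix_eq_meshMatrix {k : Type*} [Field k] (c t : ∀ ⦃a b : E7Tilde⦄, (a ⟶ b) → k) :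
    E7Matrix c t = meshMatrix c t (c E7Arrow.α₁ * t E7Arrow.α₁) := by
  funext (i : Fin 8) (j : Fin 8)
  refine Eq.trans ?_ (E7Tilde.meshMatrix_apply c t _ i j).symm
  fin_cases i <;> fin_cases j <;> simp [E7Arrow.list, E7Matrix]

/-- The additive function of `Ẽ₇`. -/
def E7Tilde.delta : E7Tilde → ℕ := fun i => (![1, 2, 3, 4, 3, 2, 1, 2] : Fin 8 → ℕ) i

theorem E7Tilde.delta_pos : ∀ i, 0 < E7Tilde.delta i := by
  decide

theorem E7Tilde.delta_additive (i : E7Tilde) :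
    ∑ j : E7Tilde, (∑ _ : i ⟶ j, E7Tilde.delta j + ∑ _ : j ⟶ i, E7Tilde.delta j)
      = 2 * E7Tilde.delta i := by
  simp only [E7Tilde.sum_hom]
  revert i
  decide

/-- The same walk from `α₁`; the branch `α₈` is entered from `α₃`. -/
theorem E7Tilde.mul_eq_of_scalesArrows {k : Type*} [Field k]
    {g : PreprojectiveAlgebra k E7Tilde ≃ₐ[k] PreprojectiveAlgebra k E7Tilde}
    (hg : PreprojectiveAlgebra.IsGradedAut g) {c t : ∀ ⦃a b : E7Tilde⦄, (a ⟶ b) → k}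
    (h : PreprojectiveAlgebra.ScalesArrows g c t) ⦃a b : E7Tilde⦄ (α : a ⟶ b) :
    c α * t α = c E7Arrow.α₁ * t E7Arrow.α₁ := by
  obtain ⟨l, hl⟩ := PreprojectiveAlgebra.mul_eq_mul_of_scalesArrows hg h
  have h₂ : c E7Arrow.α₂ * t E7Arrow.α₂ = c E7Arrow.α₁ * t E7Arrow.α₁ :=
    (hl E7Arrow.α₂).1.trans (hl E7Arrow.α₁).2.symm
  have h₃ : c E7Arrow.α₃ * t E7Arrow.α₃ = c E7Arrow.α₁ * t E7Arrow.α₁ :=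
    ((hl E7Arrow.α₃).1.trans (hl E7Arrow.α₂).2.symm).trans h₂
  have h₄ : c E7Arrow.α₄ * t E7Arrow.α₄ = c E7Arrow.α₁ * t E7Arrow.α₁ :=
    ((hl E7Arrow.α₄).1.trans (hl E7Arrow.α₃).2.symm).trans h₃
  have h₅ : c E7Arrow.α₅ * t E7Arrow.α₅ = c E7Arrow.α₁ * t E7Arrow.α₁ :=
    ((hl E7Arrow.α₅).1.trans (hl E7Arrow.α₄).2.symm).trans h₄
  have h₆ : c E7Arrow.α₆ * t E7Arrow.α₆ = c E7Arrow.α₁ * t E7Arrow.α₁ :=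
    ((hl E7Arrow.α₆).1.trans (hl E7Arrow.α₅).2.symm).trans h₅
  have h₈ : c E7Arrow.α₈ * t E7Arrow.α₈ = c E7Arrow.α₁ * t E7Arrow.α₁ :=
    ((hl E7Arrow.α₈).1.trans (hl E7Arrow.α₃).2.symm).trans h₃
  have key : ∀ {i j : Fin 8} (α : E7Arrow i j),
      @c i j α * @t i j α = c E7Arrow.α₁ * t E7Arrow.α₁ := by
    intro i j α
    cases α
    · rfl
    · exact h₂
    · exact h₃
    · exact h₄
    · exact h₅
    · exact h₆
    · exact h₈
  exact key α

/-- The list of arrows between two vertices of `Ẽ₈`. -/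
def E8Arrow.list : ∀ i j : Fin 9, List (E8Arrow i j)
  | 0, 1 => [.α₁]
  | 1, 2 => [.α₂]
  | 2, 3 => [.α₃]
  | 3, 4 => [.α₄]
  | 4, 5 => [.α₅]
  | 5, 6 => [.α₆]
  | 6, 7 => [.α₇]
  | 5, 8 => [.α₉]
  | _, _ => []

theorem E8Arrow.list_eq {i j : Fin 9} (α : E8Arrow i j) : E8Arrow.list i j = [α] := by
  cases α <;> rfl

theorem E8Tilde.sum_hom {M : Type*} [AddCommMonoid M] (i j : E8Tilde) (F : (i ⟶ j) → M) :
    ∑ α, F α = ((E8Arrow.list i j).map F).sum :=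
  Fintype.sum_eq_list_sum_of_subsingleton (ι := i ⟶ j) _ (fun α => E8Arrow.list_eq α) F

open PowerSeries in
theorem E8Tilde.meshMatrix_apply {k : Type*} [Field k]
    (c t : ∀ ⦃a b : E8Tilde⦄, (a ⟶ b) → k) (l : k) (i j : Fin 9) :
    meshMatrix c t l i j = (if i = j then 1 + C l * X ^ 2 else 0)
      - (((E8Arrow.list i j).map fun α => C (c α) * X).sum
        + ((E8Arrow.list j i).map fun α => C (t α) * X).sum) :=
  congrArg₂ _ rfl (congrArg₂ _ (E8Tilde.sum_hom i j _) (E8Tilde.sum_hom j i _))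

theorem E8Matrix_eq_meshMatrix {k : Type*} [Field k] (c t : ∀ ⦃a b : E8Tilde⦄, (a ⟶ b) → k) :
    E8Matrix c t = meshMatrix c t (c E8Arrow.α₁ * t E8Arrow.α₁) := by
  funext (i : Fin 9) (j : Fin 9)
  refine Eq.trans ?_ (E8Tilde.meshMatrix_apply c t _ i j).symm
  fin_cases i <;> fin_cases j <;> simp [E8Arrow.list, E8Matrix]

/-- The additive function of `Ẽ₈`. -/
def E8Tilde.delta : E8Tilde → ℕ := fun i => (![1, 2, 3, 4, 5, 6, 4, 2, 3] : Fin 9 → ℕ) i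

theorem E8Tilde.delta_pos : ∀ i, 0 < E8Tilde.delta i := by
  decide

theorem E8Tilde.delta_additive (i : E8Tilde) :
    ∑ j : E8Tilde, (∑ _ : i ⟶ j, E8Tilde.delta j + ∑ _ : j ⟶ i, E8Tilde.delta j)
      = 2 * E8Tilde.delta i := by
  simp only [E8Tilde.sum_hom]
  revert i
  decide

/-- The same walk from `α₁`; the branch `α₉` is entered from `α₅`. -/
theorem E8Tilde.mul_eq_of_scalesArrows {k : Type*} [Field k]
    {g : PreprojectiveAlgebra k E8Tilde ≃ₐ[k] PreprojectiveAlgebra k E8Tilde}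
    (hg : PreprojectiveAlgebra.IsGradedAut g) {c t : ∀ ⦃a b : E8Tilde⦄, (a ⟶ b) → k}
    (h : PreprojectiveAlgebra.ScalesArrows g c t) ⦃a b : E8Tilde⦄ (α : a ⟶ b) :
    c α * t α = c E8Arrow.α₁ * t E8Arrow.α₁ := by
  obtain ⟨l, hl⟩ := PreprojectiveAlgebra.mul_eq_mul_of_scalesArrows hg h
  have h₂ : c E8Arrow.α₂ * t E8Arrow.α₂ = c E8Arrow.α₁ * t E8Arrow.α₁ :=
    (hl E8Arrow.α₂).1.trans (hl E8Arrow.α₁).2.symm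
  have h₃ : c E8Arrow.α₃ * t E8Arrow.α₃ = c E8Arrow.α₁ * t E8Arrow.α₁ :=
    ((hl E8Arrow.α₃).1.trans (hl E8Arrow.α₂).2.symm).trans h₂
  have h₄ : c E8Arrow.α₄ * t E8Arrow.α₄ = c E8Arrow.α₁ * t E8Arrow.α₁ :=
    ((hl E8Arrow.α₄).1.trans (hl E8Arrow.α₃).2.symm).trans h₃
  have h₅ : c E8Arrow.α₅ * t E8Arrow.α₅ = c E8Arrow.α₁ * t E8Arrow.α₁ :=
    ((hl E8Arrow.α₅).1.trans (hl E8Arrow.α₄).2.symm).trans h₄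
  have h₆ : c E8Arrow.α₆ * t E8Arrow.α₆ = c E8Arrow.α₁ * t E8Arrow.α₁ :=
    ((hl E8Arrow.α₆).1.trans (hl E8Arrow.α₅).2.symm).trans h₅
  have h₇ : c E8Arrow.α₇ * t E8Arrow.α₇ = c E8Arrow.α₁ * t E8Arrow.α₁ :=
    ((hl E8Arrow.α₇).1.trans (hl E8Arrow.α₆).2.symm).trans h₆
  have h₉ : c E8Arrow.α₉ * t E8Arrow.α₉ = c E8Arrow.α₁ * t E8Arrow.α₁ :=
    ((hl E8Arrow.α₉).1.trans (hl E8Arrow.α₅).2.symm).trans h₅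
  have key : ∀ {i j : Fin 9} (α : E8Arrow i j),
      @c i j α * @t i j α = c E8Arrow.α₁ * t E8Arrow.α₁ := by
    intro i j α
    cases α
    · rfl
    · exact h₂
    · exact h₃
    · exact h₄
    · exact h₅
    · exact h₆
    · exact h₇
    · exact h₉
  exact key α

theorem proposition4p8 (k : Type*) [Field k] [IsAlgClosed k] [CharZero k] :
    (∀ (g : PreprojectiveAlgebra k E6Tilde ≃ₐ[k] PreprojectiveAlgebra k E6Tilde)
        (hg : PreprojectiveAlgebra.IsGradedAut g) (c t : ∀ ⦃a b : E6Tilde⦄, (a ⟶ b) → k),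
        PreprojectiveAlgebra.ScalesArrows g c t →
        IsUnit (E6Matrix c t).det ∧
        PreprojectiveAlgebra.lowerVectorTrace g hg
          = (E6Matrix c t)⁻¹.mulVec (fun _ => 1) ∧
        PreprojectiveAlgebra.upperVectorTrace g hg
          = (E6Matrix c t).transpose⁻¹.mulVec (fun _ => 1)) ∧
    (∀ (g : PreprojectiveAlgebra k E7Tilde ≃ₐ[k] PreprojectiveAlgebra k E7Tilde)
        (hg : PreprojectiveAlgebra.IsGradedAut g) (c t : ∀ ⦃a b : E7Tilde⦄, (a ⟶ b) → k),
        PreprojectiveAlgebra.ScalesArrows g c t →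
        IsUnit (E7Matrix c t).det ∧
        PreprojectiveAlgebra.lowerVectorTrace g hg
          = (E7Matrix c t)⁻¹.mulVec (fun _ => 1) ∧
        PreprojectiveAlgebra.upperVectorTrace g hg
          = (E7Matrix c t).transpose⁻¹.mulVec (fun _ => 1)) ∧
    (∀ (g : PreprojectiveAlgebra k E8Tilde ≃ₐ[k] PreprojectiveAlgebra k E8Tilde)
        (hg : PreprojectiveAlgebra.IsGradedAut g) (c t : ∀ ⦃a b : E8Tilde⦄, (a ⟶ b) → k),
        PreprojectiveAlgebra.ScalesArrows g c t →
        IsUnit (E8Matrix c t).det ∧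
        PreprojectiveAlgebra.lowerVectorTrace g hg
          = (E8Matrix c t)⁻¹.mulVec (fun _ => 1) ∧
        PreprojectiveAlgebra.upperVectorTrace g hg
          = (E8Matrix c t).transpose⁻¹.mulVec (fun _ => 1)) :=
  ⟨fun _ hg c t h => PreprojectiveAlgebra.vectorTrace_eq E6Tilde.delta_pos E6Tilde.delta_additive hg
      h (E6Tilde.mul_eq_of_scalesArrows hg h) (E6Matrix_eq_meshMatrix c t),
    fun _ hg c t h => PreprojectiveAlgebra.vectorTrace_eq E7Tilde.delta_pos E7Tilde.delta_additive hg
      h (E7Tilde.mul_eq_of_scalesArrows hg h) (E7Matrix_eq_meshMatrix c t),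
    fun _ hg c t h => PreprojectiveAlgebra.vectorTrace_eq E8Tilde.delta_pos E8Tilde.delta_additive hg
      h (E8Tilde.mul_eq_of_scalesArrows hg h) (E8Matrix_eq_meshMatrix c t)⟩
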